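/- Let $k$ be an algebraically closed field of characteristic $0$, let $R = k[[x,y]]$, and let $f \in R$ be the germ of an isolated plane curve singularity, i.e. $f(0)=0$ and $\dim_k R/(f,\partial f/\partial x,\partial f/\partial y) < \infty$. Let $\delta_1,\dots,\delta_d \in R$ represent a $k$-basis of the space of first-order deformations $\mathrm{Def}^1(f) = R/(f,\partial f/\partial x,\partial f/\partial y)$. For $a \in k^d$, the associated one-parameter deformation $X/B$ of $f$ has $\mathcal O_B = k[[t]]$ and $\mathcal O_X = R[[t]]/(F)$ with $F = f + t\sum_i a_i\delta_i$. It is called admissible if the locus $\mathrm{Sing}(X/B)$, cut out in $\mathcal O_X$ by $\partial F/\partial x$ and $\partial F/\partial y$, has codimension at least $2$ in $X$. For $m \ge 1$ put $\mathcal P^m_{X/B} = (\mathcal O_X\otimes_{\mathcal O_B}\mathcal O_X)/I_\Delta^m$, where $I_\Delta$ is the kernel of multiplication. For a list $\tau = (\tau_1,\dots,\tau_m)$ of elements of $\mathcal P^m_{X/B}$ let $I_\tau^m = \bigl(\det (e_i(\tau_j))\bigr) \subset \mathcal O_X$, where $(e_1,\dots,e_m)$ is a basis of the dual $\mathcal O_X$-module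 $(\mathcal P^m_{X/B})^\vee$. The $m$-th order weight-$1$ automatic degeneracy of $f$ is $$\mathrm{AD}_{(1)}^m(f) = \min_{X/B}\ \min_{\tau}\ \dim_k \mathcal O_X/\bigl((t) + I_\tau^m\bigr),$$ the minima being over all admissible one-parameter deformations $X/B$ and all lists $\tau$ of $m$ elements of $\mathcal P^m_{X/B}$. Let $J(f) = (\partial f/\partial x,\partial f/\partial y) \subset R/(f)$ be the Jacobian ideal. Then its Hilbert–Samuel multiplicity $e_f = \lim_{s\to\infty} \frac1s \dim_k R/(f, J(f)^s)$ exists, is a non-negative integer, and $$\mathrm{AD}_{(1)}^2(f) = e_f .$$ In particular, the number of second-order weight-$1$ inflection points limiting to the singularity in a general one-parameter deformation is $e_f$. That is, for all $a$ in some non-empty Zariski-open subset of $k^d$, the deformation $X/B$ is admissible, $(\mathcal P^2_{X/B})^\vee$ is free of rank $2$, the minimum $\mathrm{AD}_{(1)}^2(f)$ is attained by some $\tau$ in $\mathcal P^2_{X/B}$, and for every $\tau$ attaining it $$\dim_{K} \bigl(\mathcal O_X/I_\tau^2\bigr)\otimes_{k[[t]]} K = e_f, \qquad K = \overline{k((t))}.$$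 -/

import Mathlib

open scoped TensorProduct Topology

noncomputable section

namespace AutDeg

/-- The dimension of a vector space, with value `⊤` when it is infinite. -/
def vdim (K V : Type*) [Field K] [AddCommGroup V] [Module K V] : ℕ∞ :=
  Cardinal.toENat (Module.rank K V)

section Germ

variable (k : Type*) [Field k]

/-- The ring `R = k[[x, y]]`; the variable `x` has index `0` and `y` has index `1`. -/
abbrev PlaneRing : Type _ := MvPowerSeries (Fin 2) k

variable {k}

/-- The ideal `(f, ∂f/∂x, ∂f/∂y)` of `R`. -/
def tjurinaIdeal (f : PlaneRing k) : Ideal (PlaneRing k) :=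
  Ideal.span {f, MvPowerSeries.pderiv k 0 f, MvPowerSeries.pderiv k 1 f}

/-- `f` is the germ of an isolated complete intersection singularity in the plane: it vanishes
at the origin and the scheme `f = ∂f/∂x = ∂f/∂y = 0` is supported at the origin (has finite
length). In particular `f ≠ 0`. Smooth germs are not excluded. -/
structure IsPlanarICIS (f : PlaneRing k) : Prop where
  vanishes : MvPowerSeries.constantCoeff f = 0
  isolated : FiniteDimensional k (PlaneRing k ⧸ tjurinaIdeal f)

/-- The power series `δ i` represent a `k`-basis of the space
`Def¹(f) = R / (f, ∂f/∂x, ∂f/∂y)` of first-order deformations of `f`. -/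
def IsDeformationBasis (f : PlaneRing k) {d : ℕ} (δ : Fin d → PlaneRing k) : Prop :=
  ∃ b : Module.Basis (Fin d) k (PlaneRing k ⧸ tjurinaIdeal f),
    ∀ i, b i = Ideal.Quotient.mk (tjurinaIdeal f) (δ i)

/-- The Jacobian ideal `J(f) = (∂f/∂x, ∂f/∂y)` of `R / (f)`. -/
def jacobianIdeal (f : PlaneRing k) : Ideal (PlaneRing k ⧸ Ideal.span {f}) :=
  Ideal.span {Ideal.Quotient.mk (Ideal.span {f}) (MvPowerSeries.pderiv k 0 f),
    Ideal.Quotient.mk (Ideal.span {f}) (MvPowerSeries.pderiv k 1 f)}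

/-- `e` is the Hilbert-Samuel multiplicity of the ideal `I` of the (one-dimensional)
`k`-algebra `A`: all powers of `I` have finite colength, and `dim_k (A / I ^ s) / s`
tends to `e` as `s → ∞`. -/
def HasHilbertSamuelMultiplicity (k : Type*) [Field k] {A : Type*} [CommRing A] [Algebra k A]
    (I : Ideal A) (e : ℝ) : Prop :=
  (∀ s : ℕ, FiniteDimensional k (A ⧸ I ^ s)) ∧
    Filter.Tendsto (fun s : ℕ => (Module.finrank k (A ⧸ I ^ s) : ℝ) / (s : ℝ))
      Filter.atTop (𝓝 e)

end Germ

section Deformation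

variable {k : Type*} [Field k] (f : PlaneRing k) {d : ℕ} (δ : Fin d → PlaneRing k)
  (a : Fin d → k)

/-- The equation `F = f + t · ∑ aᵢ δᵢ` in `R[[t]]` of the one-parameter deformation obtained
from the versal family `f + ∑ αᵢ δᵢ` by the base change `αᵢ ↦ aᵢ t`. -/
def deformationEq : PowerSeries (PlaneRing k) :=
  PowerSeries.C f + PowerSeries.X * PowerSeries.C (∑ i, a i • δ i)

/-- The coordinate ring `𝒪_X = R[[t]] / (F)` of the total space of the one-parameter deformation
`X / B`. It is an algebra over the coordinate ring `𝒪_B = k[[t]]` of the base. -/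
abbrev TotalRing : Type _ :=
  PowerSeries (PlaneRing k) ⧸ Ideal.span {deformationEq f δ a}

/-- The partial derivative of an element of `R[[t]] = k[[x, y]][[t]]` with respect to one of the
variables `x`, `y`, taken coefficient by coefficient in `t`. -/
def fiberDeriv (i : Fin 2) (F : PowerSeries (PlaneRing k)) : PowerSeries (PlaneRing k) :=
  PowerSeries.mk fun n => MvPowerSeries.pderiv k i (PowerSeries.coeff n F)

/-- The ideal `(∂F/∂x, ∂F/∂y)` of `𝒪_X`, which cuts out the locus `Sing(X/B)` where
`X → B` is not smooth. -/
def singIdeal : Ideal (TotalRing f δ a) :=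
  Ideal.span {Ideal.Quotient.mk _ (fiberDeriv 0 (deformationEq f δ a)),
    Ideal.Quotient.mk _ (fiberDeriv 1 (deformationEq f δ a))}

/-- The deformation `X / B` is an admissible family: `Sing(X/B)` has codimension (at least) `2`
in `X`. The other requirements on an admissible family (flatness over `B`, fibres that are reduced
complete intersection curves) then hold for every deformation of an isolated plane curve
singularity. -/
def IsAdmissible : Prop := 2 ≤ (singIdeal f δ a).height

/-- The ideal `I_{X₀} = (t)` of the special fibre in `𝒪_X`. -/
def specialFiberIdeal : Ideal (TotalRing f δ a) :=
  Ideal.span {algebraMap (PowerSeries k) (TotalRing f δ a) PowerSeries.X}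

/-- The module of principal parts `(𝒪_X ⊗_{𝒪_B} 𝒪_X) / I_Δ ^ m`, where `I_Δ` is the kernel of the
multiplication map; `𝒪_X` acts through the left factor. Replacing the tensor product by
its completion `k[[x,y,u,v,t]] / (F(x,y,t), F(u,v,t))` divides this module by elements that every
functional with values in `𝒪_X` kills, so it changes none of the matrices below. -/
abbrev PrincipalParts (m : ℕ) : Type _ :=
  (TotalRing f δ a ⊗[PowerSeries k] TotalRing f δ a) ⧸
    (KaehlerDifferential.ideal (PowerSeries k) (TotalRing f δ a)) ^ m

/-- The ideal of maximal minors of the `m × m` matrix `(e_i (τ_j))`, for functionals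
`e_1, …, e_m` on the module of principal parts and elements `τ_1, …, τ_m` of it. When the `e_i` are
a basis of the dual module, it cuts out the degeneracy locus of the map
`𝒪_X ^ m → (principal parts)^∨∨` given by `τ_1, …, τ_m`. -/
def degeneracyIdeal {m : ℕ}
    (e : Fin m → Module.Dual (TotalRing f δ a) (PrincipalParts f δ a m))
    (τ : Fin m → PrincipalParts f δ a m) : Ideal (TotalRing f δ a) :=
  Ideal.span {Matrix.det (Matrix.of fun i j => e i (τ j))}

/-- `dim_k 𝒪_X / (I_{X₀} + I)`. -/
def specialMultiplicity (I : Ideal (TotalRing f δ a)) : ℕ∞ :=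
  vdim k (TotalRing f δ a ⧸ (specialFiberIdeal f δ a ⊔ I))

/-- An algebraic closure of the fraction field `k((t))` of `𝒪_B`, that is, the residue field
of the geometric generic point `η` of `B`. -/
abbrev GeometricGenericField (k : Type*) [Field k] : Type _ :=
  AlgebraicClosure (FractionRing (PowerSeries k))

/-- The multiplicity of the scheme cut out by `I` in the geometric generic fibre `X_η`:
the dimension of `(𝒪_X / I) ⊗ κ(η)` over `κ(η)`. -/
def genericMultiplicity (I : Ideal (TotalRing f δ a)) : ℕ∞ :=
  vdim (GeometricGenericField k)
    (GeometricGenericField k ⊗[PowerSeries k] (TotalRing f δ a ⧸ I))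

end Deformation

/-- The `m`-th order weight-1 automatic degeneracy of `f`, computed with the basis `δ` of
`Def¹(f)`: the minimum of `dim_k 𝒪_X / (I_{X₀} + I_τ)` over all (admissible) one-parameter
deformations `X / B` and all lists `τ` of `m` principal parts, where `I_τ` is formed with a basis
`e` of the dual of the module of principal parts (it does not depend on `e`). -/
def weightOneAutDeg {k : Type*} [Field k] (m : ℕ) (f : PlaneRing k) {d : ℕ}
    (δ : Fin d → PlaneRing k) : ℕ∞ :=
  sInf {n : ℕ∞ | ∃ a : Fin d → k, IsAdmissible f δ a ∧
    ∃ (e : Module.Basis (Fin m) (TotalRing f δ a)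
        (Module.Dual (TotalRing f δ a) (PrincipalParts f δ a m)))
      (τ : Fin m → PrincipalParts f δ a m),
      n = specialMultiplicity f δ a (degeneracyIdeal f δ a e τ)}

end AutDeg

end

/-!
Let `F_x, F_y` be the classes in `𝒪_X` of the partial derivatives of `F` along the fibres of
`X / B`. If `X / B` is admissible then `𝒪_X / (F_x, F_y)` has dimension at most zero and `𝒪_X` is
Cohen-Macaulay of dimension two, so `α F_x + β F_y = 0` has only the Koszul solutions. Since a
derivation `D` of `𝒪_X` over `k[[t]]` satisfies `F_x D(x) + F_y D(y) = 0`, it is a multiple of the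
Hamiltonian derivation `F_y ∂_x - F_x ∂_y`. Hence `(P²)^∨` is free on the multiplication and the
Hamiltonian derivation, and the ideals `I_τ` are exactly the principal ideals generated by
elements of `(F_x, F_y)`.

The ideal `(F_x, F_y)` restricts onto `J(f)` at `t = 0`, so the automatic degeneracy is the minimum
of `dim_k R / (f, h)` over `h ∈ J(f)`. Each such dimension is at least `e_f`, because
`dim_k R / (f, h ^ s) = s dim_k R / (f, h)` and `h ^ s ∈ J(f) ^ s`. Equality holds when
`J(f) ^ (n + 1) = h J(f) ^ n` for some `n`, and such an `h = f_x - c f_y` exists: `R / (f)` has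
dimension one, so for `n` large the monomials of degree `n + 1` in `f_x, f_y` are linearly dependent
modulo `z J(f) ^ (n + 1)` for a parameter `z`, and `c` is chosen off the roots of the polynomial
whose coefficients are those of the relation; Nakayama's lemma removes `z`.

The intersection number with the geometric generic fibre equals that with the special one, as
`𝒪_X / (H)` is finite and free over `k[[t]]` whenever `R / (f, H(0))` is finite over `k`.

Finally, `X / B` is admissible whenever `∑ a_i δ_i` is a unit. Otherwise `Sing (X / B)` would have a
component that is a curve finite over `B`, and in characteristic zero this curve would carry a
derivation with `dt ≠ 0`; this contradicts `F_x dx + F_y dy + F_t dt = 0`, where `F_t` is a unit.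
-/

noncomputable section

namespace AutDeg

section LocalRings

variable {A : Type*} [CommRing A]

theorem exists_eq_mul_of_mul_add_mul_eq_zero {p q s w α β : A} (hs : s ∈ Ideal.span {p, q})
    (hw : w ∈ Ideal.span {p, q}) (hs0 : s ∈ nonZeroDivisors A) (hsw : ∀ x, s ∣ w * x → s ∣ x)
    (h : α * p + β * q = 0) : ∃ c, α = c * q ∧ β = -(c * p) := by
  obtain ⟨a, b, hab⟩ := Ideal.mem_span_pair.1 hs
  obtain ⟨a', b', hab'⟩ := Ideal.mem_span_pair.1 hw
  have cancel {x : A} (hx : s * x = 0) : x = 0 :=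
    (mul_left_mem_nonZeroDivisors_eq_zero_iff hs0).1 hx
  -- Expressing the syzygy through `s` and through `w` gives a Koszul relation between `w` and `s`.
  have koszul : w * (b * α - a * β) = s * (b' * α - a' * β) := by
    rw [← hab, ← hab']
    linear_combination (a' * b - a * b') * h
  obtain ⟨c, hc⟩ := hsw _ ⟨_, koszul⟩
  refine ⟨c, sub_eq_zero.1 (cancel ?_), sub_eq_zero.1 (cancel ?_)⟩
  · linear_combination a * h + q * hc - α * hab
  · linear_combination b * h - p * hc - β * hab

variable [IsLocalRing A]

open IsLocalRing

theorem exists_pow_mem_of_isArtinianRing_quotient (I : Ideal A) [IsArtinianRing (A ⧸ I)] {z : A}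
    (hz : z ∈ maximalIdeal A) : ∃ n, z ^ n ∈ I :=
  (exists_maximalIdeal_pow_le_of_isArtinianRing_quotient I).imp fun n hn =>
    hn (Ideal.pow_mem_pow hz n)

theorem mem_nonZeroDivisors_of_isArtinianRing_quotient {h z : A}
    [IsArtinianRing (A ⧸ Ideal.span {h})] (hz : z ∈ maximalIdeal A) (hz0 : z ∈ nonZeroDivisors A) :
    h ∈ nonZeroDivisors A := by
  obtain ⟨n, hn⟩ := exists_pow_mem_of_isArtinianRing_quotient (Ideal.span {h}) hz
  obtain ⟨g, hg⟩ := Ideal.mem_span_singleton.1 hn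
  exact (mul_mem_nonZeroDivisors.1 (hg ▸ pow_mem hz0 n)).1

theorem eq_maximalIdeal_of_isArtinianRing_quotient (I : Ideal A) [IsArtinianRing (A ⧸ I)]
    {P : Ideal A} [P.IsPrime] (h : I ≤ P) : P = maximalIdeal A :=
  (le_maximalIdeal ‹P.IsPrime›.ne_top).antisymm fun _ hz =>
    have ⟨n, hn⟩ := exists_pow_mem_of_isArtinianRing_quotient I hz
    ‹P.IsPrime›.mem_of_pow_mem n (h hn)

theorem exists_mem_maximalIdeal_mem_nonZeroDivisors [IsNoetherianRing A]
    (h : ∀ x : A, (∀ y ∈ maximalIdeal A, y * x = 0) → x = 0) :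
    ∃ z ∈ maximalIdeal A, z ∈ nonZeroDivisors A := by
  by_contra! H
  obtain ⟨x, hx, hx0⟩ := SetLike.exists_of_lt
    (Ideal.bot_lt_annihilator_of_disjoint_nonZeroDivisors (Set.disjoint_left.2 H))
  refine hx0 (h x fun y hy => ?_)
  rw [mul_comm, ← smul_eq_mul]
  exact Submodule.mem_annihilator.1 hx y hy

theorem maximalIdeal_le_radical_of_ringKrullDim_le_height [IsNoetherianRing A] {I : Ideal A}
    (h : ringKrullDim A ≤ I.height) : maximalIdeal A ≤ I.radical := by
  rw [Ideal.radical_eq_sInf]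
  refine le_sInf fun P ⟨hIP, hP⟩ => ?_
  by_contra hne
  have hlt : P < maximalIdeal A := lt_of_le_not_ge (le_maximalIdeal hP.ne_top) hne
  have := Ideal.height_strict_mono_of_isPrime hlt
  rw [← maximalIdeal_height_eq_ringKrullDim, WithBot.coe_le_coe] at h
  exact (this.trans_le h).not_ge (Ideal.height_mono hIP)

theorem finite_of_isFiniteLength (k : Type*) [Field k] [Algebra k A]
    [Module.Finite k (ResidueField A)] {M : Type*} [AddCommGroup M] [Module A M] [Module k M]
    [IsScalarTower k A M] (h : IsFiniteLength A M) : Module.Finite k M := by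
  have : Module.Finite (ResidueField k) (ResidueField A) := .of_restrictScalars_finite k _ _
  have hlen : Module.length k M ≠ ⊤ := by
    rw [length_restrictScalars k A M, Module.length_eq_finrank]
    exact WithTop.mul_ne_top (Module.length_ne_top_iff.2 h) (ENat.natCast_ne_top _)
  have := (isFiniteLength_iff_isNoetherian_isArtinian.1 (Module.length_ne_top_iff.1 hlen)).1
  infer_instance

theorem finite_quotient_of_isArtinianRing (k : Type*) [Field k] [Algebra k A] [IsNoetherianRing A]
    [Module.Finite k (ResidueField A)] (I : Ideal A) [IsArtinianRing (A ⧸ I)] :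
    Module.Finite k (A ⧸ I) :=
  have : IsArtinian A (A ⧸ I) :=
    isArtinian_of_surjective_algebraMap (R := A ⧸ I) Ideal.Quotient.mk_surjective
  finite_of_isFiniteLength k (isFiniteLength_iff_isNoetherian_isArtinian.2 ⟨inferInstance, this⟩)

theorem finite_quotient_span_singleton_of_ringKrullDim_eq_one (k : Type*) [Field k] [Algebra k A]
    [IsNoetherianRing A] [Module.Finite k (ResidueField A)] (hA : ringKrullDim A = 1) {z : A}
    (hz : z ∈ maximalIdeal A) (hz0 : z ∈ nonZeroDivisors A) :
    Module.Finite k (A ⧸ Ideal.span {z}) := by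
  have hdim := ringKrullDim_quotient_span_singleton_succ_eq_ringKrullDim_of_mem_nonZeroDivisors
    hz0 hz
  have : Ring.KrullDimLE 0 (A ⧸ Ideal.span {z}) := by
    rw [Ring.krullDimLE_iff, Nat.cast_zero, ← ENat.WithBot.add_le_add_one_right_iff,
      hdim, hA, zero_add]
  have : IsArtinianRing (A ⧸ Ideal.span {z}) := IsNoetherianRing.isArtinianRing_of_krullDimLE_zero
  exact finite_quotient_of_isArtinianRing k _

end LocalRings

section PowerSeries

variable {A : Type*} [CommRing A]

theorem ringKrullDim_powerSeries [IsLocalRing A] [IsNoetherianRing A] :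
    ringKrullDim (PowerSeries A) = ringKrullDim A + 1 := by
  have hker : Ideal.span {PowerSeries.X} = RingHom.ker (PowerSeries.constantCoeff (R := A)) := by
    ext x
    rw [Ideal.mem_span_singleton, PowerSeries.X_dvd_iff, RingHom.mem_ker]
  rw [← ringKrullDim_eq_of_ringEquiv ((Ideal.quotEquivOfEq hker).trans
    (RingHom.quotientKerEquivOfSurjective PowerSeries.constantCoeff_surj))]
  refine (ringKrullDim_quotient_span_singleton_succ_eq_ringKrullDim_of_mem_nonZeroDivisors
    ?_ ?_).symm
  · refine mem_nonZeroDivisors_iff_right.2 fun x hx => PowerSeries.ext fun n => ?_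
    simpa using congr(PowerSeries.coeff (n + 1) $hx)
  · rw [IsLocalRing.mem_maximalIdeal, mem_nonunits_iff, PowerSeries.isUnit_iff_constantCoeff]
    simp

theorem ringKrullDim_mvPowerSeries_fin (k : Type*) [Field k] (n : ℕ) :
    ringKrullDim (MvPowerSeries (Fin n) k) = n := by
  induction n with
  | zero =>
    rw [ringKrullDim_eq_of_ringEquiv (MvPowerSeries.isEmptyEquiv (σ := Fin 0) (R := k)).toRingEquiv]
    simp
  | succ n ih =>
    rw [ringKrullDim_eq_of_ringEquiv (MvPowerSeries.finSuccEquiv k n).toRingEquiv,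
      ringKrullDim_powerSeries, ih]
    simp

end PowerSeries

section CompleteModules

variable {B : Type*} [CommRing B]

theorem isPrecomplete_pi (I : Ideal B) [IsPrecomplete I B] (ι : Type*) [Finite ι] :
    IsPrecomplete I (ι → B) := by
  have := Fintype.ofFinite ι
  classical
  have hmem (n : ℕ) (x y : ι → B) : x ≡ y [SMOD (I ^ n • ⊤ : Submodule B (ι → B))] ↔
      ∀ i, x i ≡ y i [SMOD (I ^ n • ⊤ : Submodule B B)] := by
    simp only [SModEq.sub_mem, smul_eq_mul, Ideal.mul_top]
    refine ⟨fun h i => ?_, fun h => ?_⟩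
    · simpa using (Submodule.map_smul'' (I ^ n) ⊤ (LinearMap.proj i : (ι → B) →ₗ[B] B)).le.trans
        (Submodule.smul_mono le_rfl le_top) ⟨_, h, rfl⟩
    · rw [pi_eq_sum_univ (x - y)]
      exact Submodule.sum_mem _ fun i _ => Submodule.smul_mem_smul (h i) trivial
  refine ⟨fun f hf => ?_⟩
  choose L hL using fun i => IsPrecomplete.prec ‹IsPrecomplete I B› (f := fun n => f n i)
    fun hmn => (hmem _ _ _).1 (hf hmn) i
  exact ⟨L, fun n => (hmem _ _ _).2 fun i => hL i n⟩

theorem finite_of_finite_quotient_smul_top (I : Ideal B) [IsPrecomplete I B] (M : Type*)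
    [AddCommGroup M] [Module B M] [IsHausdorff I M]
    [Module.Finite B (M ⧸ (I • ⊤ : Submodule B M))] : Module.Finite B M := by
  obtain ⟨n, g, hg⟩ := Module.Finite.exists_fin' B (M ⧸ (I • ⊤ : Submodule B M))
  obtain ⟨g', hg'⟩ := Module.projective_lifting_property (I • ⊤ : Submodule B M).mkQ g
    (Submodule.mkQ_surjective _)
  have := isPrecomplete_pi I (Fin n)
  exact .of_surjective g' (surjective_of_mkQ_comp_surjective (I := I) (hg' ▸ hg))

end CompleteModules

section DVR

variable {B : Type*} [CommRing B] [IsDomain B] [IsDiscreteValuationRing B]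

theorem isTorsionFree_of_irreducible_smul {ϖ : B} (hϖ : Irreducible ϖ) {M : Type*}
    [AddCommGroup M] [Module B M] (h : ∀ x : M, ϖ • x = 0 → x = 0) : Module.IsTorsionFree B M := by
  have hpow (n : ℕ) (x : M) (hx : ϖ ^ n • x = 0) : x = 0 := by
    induction n with
    | zero => simpa using hx
    | succ n ih => exact ih (h _ (by rwa [smul_smul, ← pow_succ']))
  refine .of_smul_eq_zero fun b x hbx => or_iff_not_imp_left.2 fun hb => ?_
  obtain ⟨n, u, rfl⟩ := IsDiscreteValuationRing.eq_unit_mul_pow_irreducible hb hϖ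
  refine hpow n x ?_
  rwa [mul_smul, u.isUnit.smul_eq_zero] at hbx

theorem free_quotient_of_irreducible_mul_mem {ϖ : B} (hϖ : Irreducible ϖ) {O : Type*} [CommRing O]
    [Algebra B O] {I : Ideal O} [Module.Finite B (O ⧸ I)]
    (hI : ∀ x, algebraMap B O ϖ * x ∈ I → x ∈ I) : Module.Free B (O ⧸ I) := by
  have : Module.IsTorsionFree B (O ⧸ I) := isTorsionFree_of_irreducible_smul hϖ fun x hx => by
    obtain ⟨x, rfl⟩ := Ideal.Quotient.mk_surjective x
    rw [Algebra.smul_def] at hx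
    exact Ideal.Quotient.eq_zero_iff_mem.2 (hI x (Ideal.Quotient.eq_zero_iff_mem.1 hx))
  infer_instance

open PowerSeries IsLocalRing in
theorem finrank_quotient_span_X {k S : Type*} [Field k] [CommRing S] [Algebra k⟦X⟧ S] [Algebra k S]
    [IsScalarTower k k⟦X⟧ S] [Module.Finite k⟦X⟧ S] [Module.Free k⟦X⟧ S] :
    Module.finrank k (S ⧸ Ideal.span {algebraMap k⟦X⟧ S X}) = Module.finrank k⟦X⟧ S := by
  have hmap : (maximalIdeal k⟦X⟧).map (algebraMap k⟦X⟧ S) =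
      Ideal.span {algebraMap k⟦X⟧ S X} := by
    rw [maximalIdeal_eq_span_X, Ideal.map_span, Set.image_singleton]
  have hk : Module.finrank k (k⟦X⟧ ⧸ maximalIdeal k⟦X⟧) = 1 := by
    refine (LinearEquiv.ofBijective (Algebra.linearMap k _)
      ⟨FaithfulSMul.algebraMap_injective k _, fun x => ?_⟩).finrank_eq.symm.trans
        (Module.finrank_self k)
    obtain ⟨f, rfl⟩ := Ideal.Quotient.mk_surjective x
    refine ⟨constantCoeff f, Ideal.Quotient.eq.2 ?_⟩
    rw [← ker_coeff_eq_max_ideal, RingHom.mem_ker, map_sub]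
    simp
  let := Ideal.Quotient.field (maximalIdeal k⟦X⟧)
  have : IsScalarTower k (k⟦X⟧ ⧸ maximalIdeal k⟦X⟧)
      (S ⧸ (maximalIdeal k⟦X⟧).map (algebraMap k⟦X⟧ S)) := .to₁₃₄ k k⟦X⟧ _ _
  rw [← hmap, ← finrank_quotient_map (R := k⟦X⟧),
    ← Module.finrank_mul_finrank k (k⟦X⟧ ⧸ maximalIdeal k⟦X⟧), hk, one_mul]

end DVR

section Multiplicity

variable (k : Type*) [Field k] {A : Type*} [CommRing A] [Algebra k A]

theorem finite_quotient_of_le {I J : Ideal A} (h : I ≤ J) [Module.Finite k (A ⧸ I)] :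
    Module.Finite k (A ⧸ J) :=
  .of_surjective (Ideal.Quotient.factorₐ k h).toLinearMap (Ideal.Quotient.factor_surjective h)

theorem finrank_quotient_le_of_le {I J : Ideal A} (h : I ≤ J) [Module.Finite k (A ⧸ I)] :
    Module.finrank k (A ⧸ J) ≤ Module.finrank k (A ⧸ I) :=
  LinearMap.finrank_le_finrank_of_surjective (f := (Ideal.Quotient.factorₐ k h).toLinearMap)
    (Ideal.Quotient.factor_surjective h)

theorem finite_quotient_span_singleton_mul (x : A) (K : Ideal A) [Module.Finite k (A ⧸ K)]
    [Module.Finite k (A ⧸ Ideal.span {x})] : Module.Finite k (A ⧸ (Ideal.span {x} * K)) := by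
  rw [← smul_eq_mul, Submodule.ideal_span_singleton_smul]
  exact .of_exact (f := (Ideal.mulQuot x K).restrictScalars k)
    (g := (Ideal.quotOfMul x K).restrictScalars k) (Ideal.exact_mulQuot_quotOfMul K)
    (Ideal.quotOfMul_surjective K)

theorem finrank_quotient_span_singleton_mul {x : A} (hx : x ∈ nonZeroDivisors A) (K : Ideal A)
    [Module.Finite k (A ⧸ K)] [Module.Finite k (A ⧸ Ideal.span {x})] :
    Module.finrank k (A ⧸ (Ideal.span {x} * K)) =
      Module.finrank k (A ⧸ K) + Module.finrank k (A ⧸ Ideal.span {x}) := by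
  have hfin := finite_quotient_span_singleton_mul k x K
  have hlen := Module.length_eq_add_of_exact ((Ideal.mulQuot x K).restrictScalars k)
    ((Ideal.quotOfMul x K).restrictScalars k) (Ideal.mulQuot_injective K hx)
    (Ideal.quotOfMul_surjective K) (Ideal.exact_mulQuot_quotOfMul K)
  rw [← Submodule.ideal_span_singleton_smul, smul_eq_mul] at hlen
  simp only [Module.length_eq_finrank] at hlen
  exact_mod_cast hlen

theorem finite_quotient_span_singleton_pow (x : A) [Module.Finite k (A ⧸ Ideal.span {x})] (s : ℕ) :
    Module.Finite k (A ⧸ Ideal.span {x} ^ s) := by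
  induction s with
  | zero =>
    rw [pow_zero, Ideal.one_eq_top]
    infer_instance
  | succ s ih =>
    rw [pow_succ']
    exact finite_quotient_span_singleton_mul k x _

theorem finrank_quotient_span_singleton_pow {x : A} (hx : x ∈ nonZeroDivisors A)
    [Module.Finite k (A ⧸ Ideal.span {x})] (s : ℕ) :
    Module.finrank k (A ⧸ Ideal.span {x} ^ s) = s * Module.finrank k (A ⧸ Ideal.span {x}) := by
  induction s with
  | zero =>
    rw [pow_zero, Ideal.one_eq_top, zero_mul]
    exact Module.finrank_zero_of_subsingleton
  | succ s ih =>
    have := finite_quotient_span_singleton_pow k x s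
    rw [pow_succ', finrank_quotient_span_singleton_mul k hx, ih, add_one_mul]

theorem finite_quotient_pow [IsLocalRing A] (I : Ideal A) [Module.Finite k (A ⧸ I)] {z : A}
    (hz : z ∈ IsLocalRing.maximalIdeal A) [Module.Finite k (A ⧸ Ideal.span {z})] (s : ℕ) :
    Module.Finite k (A ⧸ I ^ s) := by
  have := IsArtinianRing.of_finite k (A ⧸ I)
  obtain ⟨n, hn⟩ := exists_pow_mem_of_isArtinianRing_quotient I hz
  have := finite_quotient_span_singleton_pow k z (n * s)
  refine finite_quotient_of_le k (I := Ideal.span {z} ^ (n * s)) ?_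
  rw [pow_mul, Ideal.span_singleton_pow]
  exact Ideal.pow_right_mono ((Ideal.span_singleton_le_iff_mem _).2 hn) s

theorem exists_sum_smul_mem_span_singleton_mul {z : A} (hz : z ∈ nonZeroDivisors A) (K : Ideal A)
    [Module.Finite k (A ⧸ K)] [Module.Finite k (A ⧸ Ideal.span {z})] {N : ℕ}
    (hN : Module.finrank k (A ⧸ Ideal.span {z}) < N) (v : Fin N → A) (hv : ∀ i, v i ∈ K) :
    ∃ φ : Fin N → k, ∑ i, φ i • v i ∈ Ideal.span {z} * K ∧ φ ≠ 0 := by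
  have := finite_quotient_span_singleton_mul k z K
  let g := (Ideal.Quotient.factorₐ k (Ideal.mul_le_right : Ideal.span {z} * K ≤ K)).toLinearMap
  have hg : g.range = ⊤ :=
    LinearMap.range_eq_top.2 (Ideal.Quotient.factor_surjective Ideal.mul_le_right)
  have hker : Module.finrank k g.ker < N := by
    have := LinearMap.finrank_range_add_finrank_ker g
    rw [hg, finrank_top, finrank_quotient_span_singleton_mul k hz K] at this
    omega
  let w : Fin N → g.ker := fun i =>
    ⟨Ideal.Quotient.mk _ (v i), Ideal.Quotient.eq_zero_iff_mem.2 (hv i)⟩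
  obtain ⟨φ, hφ, i, hi⟩ := Fintype.not_linearIndependent_iff.1 fun h : LinearIndependent k w =>
    hker.not_ge (by simpa using h.fintype_card_le_finrank)
  refine ⟨φ, Ideal.Quotient.eq_zero_iff_mem.1 ?_, fun h => hi (congrFun h i)⟩
  rw [map_sum]
  simpa using! congr(($hφ : A ⧸ (Ideal.span {z} * K)))

section Pair

variable {p q : A}

theorem pow_mul_pow_mem_span_pair_pow (p q : A) {i j n : ℕ} (h : i + j = n) :
    p ^ i * q ^ j ∈ Ideal.span {p, q} ^ n := by
  rw [← h, pow_add]
  exact Ideal.mul_mem_mul (Ideal.pow_mem_pow (Ideal.subset_span (by simp)) _)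
    (Ideal.pow_mem_pow (Ideal.subset_span (by simp)) _)

theorem span_pair_pow_le {n : ℕ} {K : Ideal A} (h : ∀ j ≤ n, p ^ j * q ^ (n - j) ∈ K) :
    Ideal.span {p, q} ^ n ≤ K := by
  rw [Ideal.span_insert, ← Submodule.add_eq_sup, add_pow, Ideal.sum_eq_sup]
  refine Finset.sup_le fun j hj => Ideal.mul_le_left.trans ?_
  rw [Ideal.span_singleton_pow, Ideal.span_singleton_pow, Ideal.span_singleton_mul_span_singleton,
    Ideal.span_singleton_le_iff_mem]
  exact h j (Finset.mem_range_succ_iff.1 hj)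

theorem pow_mul_pow_sub_mem_span_singleton_mul (p q c : A) {n j : ℕ} (hj : j ≤ n + 1) :
    p ^ j * q ^ (n + 1 - j) - c ^ j * q ^ (n + 1) ∈
      Ideal.span {p - c * q} * Ideal.span {p, q} ^ n := by
  induction j with
  | zero => simp
  | succ j ih =>
    have h1 := Ideal.mul_mem_left _ c (ih (by omega))
    have h2 : (p - c * q) * (p ^ j * q ^ (n - j)) ∈
        Ideal.span {p - c * q} * Ideal.span {p, q} ^ n :=
      Ideal.mul_mem_mul (Ideal.mem_span_singleton_self _)
        (pow_mul_pow_mem_span_pair_pow p q (by omega))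
    convert Ideal.add_mem _ h1 h2 using 1
    rw [show n + 1 - (j + 1) = n - j by omega, show n + 1 - j = n - j + 1 by omega]
    ring

theorem span_pair_pow_succ_le_of_pow_mem {c : A} {n : ℕ} {K : Ideal A}
    (hK : Ideal.span {p - c * q} * Ideal.span {p, q} ^ n ≤ K) (hq : q ^ (n + 1) ∈ K) :
    Ideal.span {p, q} ^ (n + 1) ≤ K :=
  span_pair_pow_le fun _ hj => (Submodule.sub_mem_iff_left K (Ideal.mul_mem_left _ _ hq)).1
    (hK (pow_mul_pow_sub_mem_span_singleton_mul p q c hj))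

end Pair

variable {k} in
theorem exists_sum_mul_pow_ne_zero [Infinite k] {N : ℕ} {φ : Fin N → k} (hφ : φ ≠ 0) :
    ∃ c : k, ∑ i, φ i * c ^ (i : ℕ) ≠ 0 := by
  by_contra! h
  let g : Fin N ↪ k := Fin.valEmbedding.trans (Infinite.natEmbedding k)
  exact hφ (Matrix.eq_zero_of_forall_index_sum_mul_pow_eq_zero g.injective fun j => h (g j))

theorem exists_pow_mem_sup [Infinite k] (p q : A) {z : A} (hz : z ∈ nonZeroDivisors A)
    [Module.Finite k (A ⧸ Ideal.span {z})] {n : ℕ}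
    (hn : Module.finrank k (A ⧸ Ideal.span {z}) ≤ n)
    [Module.Finite k (A ⧸ Ideal.span {p, q} ^ (n + 1))] :
    ∃ c : A, q ^ (n + 1) ∈ Ideal.span {p - c * q} * Ideal.span {p, q} ^ n ⊔
      Ideal.span {z} * Ideal.span {p, q} ^ (n + 1) := by
  obtain ⟨φ, hφ, hφ0⟩ := exists_sum_smul_mem_span_singleton_mul k hz (Ideal.span {p, q} ^ (n + 1))
    (N := n + 2) (by omega) (fun j => p ^ (j : ℕ) * q ^ (n + 1 - j)) fun j =>
      pow_mul_pow_mem_span_pair_pow p q (by omega)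
  obtain ⟨c, hc⟩ := exists_sum_mul_pow_ne_zero hφ0
  refine ⟨algebraMap k A c, (Ideal.unit_mul_mem_iff_mem _
    ((IsUnit.mk0 _ hc).map (algebraMap k A))).1 ?_⟩
  have hsum : ∑ i, φ i •
      (p ^ (i : ℕ) * q ^ (n + 1 - i) - algebraMap k A c ^ (i : ℕ) * q ^ (n + 1)) ∈
        Ideal.span {p - algebraMap k A c * q} * Ideal.span {p, q} ^ n := by
    refine Ideal.sum_mem _ fun i _ => ?_
    rw [Algebra.smul_def]
    exact Ideal.mul_mem_left _ _ (pow_mul_pow_sub_mem_span_singleton_mul p q _ (by omega))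
  convert Submodule.sub_mem _ (Ideal.mem_sup_right hφ) (Ideal.mem_sup_left hsum) using 1
  rw [← Finset.sum_sub_distrib, map_sum, Finset.sum_mul]
  refine Finset.sum_congr rfl fun i _ => ?_
  rw [← smul_sub, sub_sub_cancel, Algebra.smul_def, map_mul, map_pow, mul_assoc]

theorem exists_span_pair_pow_succ_eq [Infinite k] [IsLocalRing A] [IsNoetherianRing A] (p q : A)
    [Module.Finite k (A ⧸ Ideal.span {p, q})] {z : A} (hz : z ∈ IsLocalRing.maximalIdeal A)
    (hz0 : z ∈ nonZeroDivisors A) [Module.Finite k (A ⧸ Ideal.span {z})] :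
    ∃ h ∈ Ideal.span {p, q}, ∃ n,
      Ideal.span {p, q} ^ (n + 1) = Ideal.span {h} * Ideal.span {p, q} ^ n := by
  set n := Module.finrank k (A ⧸ Ideal.span {z})
  have := finite_quotient_pow k (Ideal.span {p, q}) hz (n + 1)
  obtain ⟨c, hq⟩ := exists_pow_mem_sup k p q hz0 (n := n) le_rfl
  have hmem : p - c * q ∈ Ideal.span {p, q} :=
    Submodule.sub_mem _ (Ideal.subset_span (by simp))
      (Ideal.mul_mem_left _ _ (Ideal.subset_span (by simp)))
  refine ⟨p - c * q, hmem, n, le_antisymm ?_ ?_⟩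
  · refine Submodule.le_of_le_smul_of_le_jacobson_bot (I := Ideal.span {z})
      (IsNoetherian.noetherian _) ?_ (span_pair_pow_succ_le_of_pow_mem le_sup_left hq)
    rwa [IsLocalRing.jacobson_eq_maximalIdeal _ bot_ne_top, Ideal.span_singleton_le_iff_mem]
  · rw [pow_succ']
    exact Ideal.mul_mono_left ((Ideal.span_singleton_le_iff_mem _).2 hmem)

theorem tendsto_natCast_div_of_add_eq {u : ℕ → ℕ} {n c e : ℕ} (h : ∀ s, u (n + s) = c + s * e) :
    Filter.Tendsto (fun s : ℕ => (u s : ℝ) / s) Filter.atTop (𝓝 e) := by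
  have hlim : Filter.Tendsto (fun s : ℕ => ((c : ℝ) - n * e) / s + e) Filter.atTop (𝓝 (0 + e)) :=
    (tendsto_const_div_atTop_nhds_zero_nat _).add_const _
  rw [zero_add] at hlim
  refine hlim.congr' ?_
  filter_upwards [Filter.eventually_ge_atTop (n + 1)] with s hs
  obtain ⟨j, rfl⟩ := Nat.exists_eq_add_of_le (show n ≤ s by omega)
  have hne : ((n + j : ℕ) : ℝ) ≠ 0 := by exact_mod_cast (by omega : n + j ≠ 0)
  rw [h]
  field_simp
  push_cast
  ring

variable {k} {I : Ideal A}

theorem hasHilbertSamuelMultiplicity_of_pow_succ_eq {h : A} (hh : h ∈ nonZeroDivisors A)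
    [Module.Finite k (A ⧸ Ideal.span {h})] (hfin : ∀ s, Module.Finite k (A ⧸ I ^ s)) {n : ℕ}
    (hn : I ^ (n + 1) = Ideal.span {h} * I ^ n) :
    HasHilbertSamuelMultiplicity k I (Module.finrank k (A ⧸ Ideal.span {h}) : ℕ) := by
  refine ⟨hfin, tendsto_natCast_div_of_add_eq (n := n) (c := Module.finrank k (A ⧸ I ^ n))
    fun s => ?_⟩
  induction s with
  | zero => simp
  | succ s ih =>
    have hpow : I ^ (n + (s + 1)) = Ideal.span {h} * I ^ (n + s) := by
      rw [show n + (s + 1) = n + 1 + s by omega, pow_add, hn, pow_add, mul_assoc]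
    have := hfin (n + s)
    rw [hpow, finrank_quotient_span_singleton_mul k hh, ih]
    ring

theorem HasHilbertSamuelMultiplicity.le_finrank {e : ℝ} (he : HasHilbertSamuelMultiplicity k I e)
    {g : A} (hg : g ∈ I) (hg0 : g ∈ nonZeroDivisors A) [Module.Finite k (A ⧸ Ideal.span {g})] :
    e ≤ Module.finrank k (A ⧸ Ideal.span {g}) := by
  refine le_of_tendsto he.2 (Filter.eventually_atTop.2 ⟨1, fun s hs => ?_⟩)
  have := finite_quotient_span_singleton_pow k g s
  rw [div_le_iff₀ (by exact_mod_cast hs), mul_comm]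
  exact_mod_cast (finrank_quotient_le_of_le k
    (Ideal.pow_right_mono ((Ideal.span_singleton_le_iff_mem _).2 hg) s)).trans_eq
      (finrank_quotient_span_singleton_pow k hg0 s)

theorem exists_hasHilbertSamuelMultiplicity_span_pair [Infinite k] [IsLocalRing A]
    [IsNoetherianRing A] (p q : A) [Module.Finite k (A ⧸ Ideal.span {p, q})] {z : A}
    (hz : z ∈ IsLocalRing.maximalIdeal A) (hz0 : z ∈ nonZeroDivisors A)
    [Module.Finite k (A ⧸ Ideal.span {z})] :
    ∃ h ∈ Ideal.span {p, q}, Module.Finite k (A ⧸ Ideal.span {h}) ∧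
      HasHilbertSamuelMultiplicity k (Ideal.span {p, q})
        (Module.finrank k (A ⧸ Ideal.span {h}) : ℕ) := by
  obtain ⟨h, hI, n, hn⟩ := exists_span_pair_pow_succ_eq k p q hz hz0
  have hfin := finite_quotient_pow k (Ideal.span {p, q}) hz
  have hfinh : Module.Finite k (A ⧸ Ideal.span {h}) :=
    finite_quotient_of_le k (I := Ideal.span {p, q} ^ (n + 1)) (hn ▸ Ideal.mul_le_left)
  have := IsArtinianRing.of_finite k (A ⧸ Ideal.span {h})
  exact ⟨h, hI, hfinh, hasHilbertSamuelMultiplicity_of_pow_succ_eq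
    (mem_nonZeroDivisors_of_isArtinianRing_quotient hz hz0) hfin hn⟩

end Multiplicity

section PlaneCurves

open IsLocalRing

theorem isLocalRing_quotient_span_singleton {A : Type*} [CommRing A] [IsLocalRing A] {x : A}
    (hx : x ∈ maximalIdeal A) : IsLocalRing (A ⧸ Ideal.span {x}) :=
  have : Nontrivial (A ⧸ Ideal.span {x}) := Ideal.Quotient.nontrivial_iff.2 fun h =>
    (mem_maximalIdeal x).1 hx (Ideal.span_singleton_eq_top.1 h)
  .of_surjective' (Ideal.Quotient.mk _) Ideal.Quotient.mk_surjective

theorem finite_residueField_of_surjective (k : Type*) {A B : Type*} [CommRing k] [CommRing A]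
    [CommRing B] [Algebra k A] [Algebra k B] [IsLocalRing A] [IsLocalRing B]
    [Module.Finite k (ResidueField A)] (φ : A →ₐ[k] B) (hφ : Function.Surjective φ) :
    Module.Finite k (ResidueField B) :=
  have : IsLocalHom φ := ⟨(IsLocalHom.of_surjective φ.toRingHom hφ).map_nonunit⟩
  .of_surjective (ResidueField.mapAlgHom φ).toLinearMap fun y =>
    have ⟨b, hb⟩ := residue_surjective y
    have ⟨x, hx⟩ := hφ b
    ⟨residue A x, by rw [← hb, ← hx]; rfl⟩

theorem X_dvd_of_dvd_X_mul {σ R : Type*} [CommSemiring R] {i j : σ} (hij : i ≠ j)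
    {r : MvPowerSeries σ R} (h : MvPowerSeries.X i ∣ MvPowerSeries.X j * r) :
    MvPowerSeries.X i ∣ r := by
  rw [MvPowerSeries.X_dvd_iff] at h ⊢
  intro d hd
  have := h (Finsupp.single j 1 + d) (by simpa [hij.symm] using hd)
  rwa [MvPowerSeries.X, MvPowerSeries.coeff_add_monomial_mul, one_mul] at this

variable {k : Type*} [Field k]

theorem mem_maximalIdeal_planeRing {r : PlaneRing k} :
    r ∈ maximalIdeal (PlaneRing k) ↔ MvPowerSeries.constantCoeff r = 0 := by
  rw [mem_maximalIdeal, mem_nonunits_iff, MvPowerSeries.isUnit_iff_constantCoeff,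
    isUnit_iff_ne_zero, not_not]

theorem X_ne_zero_planeRing (i : Fin 2) : (MvPowerSeries.X i : PlaneRing k) ≠ 0 :=
  nonZeroDivisors.ne_zero MvPowerSeries.X_mem_nonzeroDivisors

instance finite_residueField_planeRing : Module.Finite k (ResidueField (PlaneRing k)) :=
  .of_surjective (Algebra.linearMap k _) fun y => by
    obtain ⟨r, rfl⟩ := residue_surjective y
    refine ⟨MvPowerSeries.constantCoeff r, ?_⟩
    change residue _ (MvPowerSeries.C (MvPowerSeries.constantCoeff r)) = residue _ r
    rw [← sub_eq_zero, ← map_sub, residue_eq_zero_iff, mem_maximalIdeal_planeRing, map_sub,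
      MvPowerSeries.constantCoeff_C, sub_self]

/-- The coordinate ring `k[[x, y]] / (f)` of the germ of the plane curve `f = 0`; it is the ring
of the special fibre of every deformation of `f`. -/
abbrev CurveRing (f : PlaneRing k) : Type _ := PlaneRing k ⧸ Ideal.span {f}

variable {f : PlaneRing k}

theorem ringKrullDim_curveRing (hf : f ∈ maximalIdeal (PlaneRing k)) (hf0 : f ≠ 0) :
    ringKrullDim (CurveRing f) = 1 := by
  have h := ringKrullDim_quotient_span_singleton_succ_eq_ringKrullDim_of_mem_nonZeroDivisors
    (mem_nonZeroDivisors_of_ne_zero hf0) hf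
  rw [ringKrullDim_mvPowerSeries_fin] at h
  exact ENat.WithBot.add_one_cancel.1 (h.trans one_add_one_eq_two.symm)

theorem exists_mem_nonZeroDivisors_curveRing [IsLocalRing (CurveRing f)] (hf0 : f ≠ 0) :
    ∃ z ∈ maximalIdeal (CurveRing f), z ∈ nonZeroDivisors (CurveRing f) := by
  refine exists_mem_maximalIdeal_mem_nonZeroDivisors fun g hg => ?_
  obtain ⟨g, rfl⟩ := Ideal.Quotient.mk_surjective g
  have hX (i : Fin 2) : f ∣ MvPowerSeries.X i * g := by
    rw [← Ideal.mem_span_singleton, ← Ideal.Quotient.eq_zero_iff_mem, map_mul]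
    refine hg _ ((mem_maximalIdeal _).2 fun h => ?_)
    exact (mem_maximalIdeal _).1 (mem_maximalIdeal_planeRing.2 (MvPowerSeries.constantCoeff_X i))
      ((IsLocalHom.of_surjective _ Ideal.Quotient.mk_surjective).map_nonunit _ h)
  obtain ⟨a, ha⟩ := hX 0
  obtain ⟨b, hb⟩ := hX 1
  obtain ⟨c, rfl⟩ : MvPowerSeries.X 0 ∣ a := X_dvd_of_dvd_X_mul zero_ne_one
    ⟨b, mul_left_cancel₀ hf0 (by
      linear_combination MvPowerSeries.X 0 * hb - MvPowerSeries.X 1 * ha)⟩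
  rw [Ideal.Quotient.eq_zero_iff_mem, Ideal.mem_span_singleton]
  exact ⟨c, mul_left_cancel₀ (X_ne_zero_planeRing 0) (by rw [ha]; ring)⟩

theorem isLocalRing_curveRing (hf : MvPowerSeries.constantCoeff f = 0) :
    IsLocalRing (CurveRing f) :=
  isLocalRing_quotient_span_singleton (mem_maximalIdeal_planeRing.2 hf)

theorem exists_parameter_curveRing [IsLocalRing (CurveRing f)]
    (hf : MvPowerSeries.constantCoeff f = 0) (hf0 : f ≠ 0) :
    ∃ z ∈ maximalIdeal (CurveRing f), z ∈ nonZeroDivisors (CurveRing f) ∧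
      Module.Finite k (CurveRing f ⧸ Ideal.span {z}) := by
  have := finite_residueField_of_surjective k (Ideal.Quotient.mkₐ k (Ideal.span {f}))
    (Ideal.Quotient.mkₐ_surjective k _)
  obtain ⟨z, hz, hz0⟩ := exists_mem_nonZeroDivisors_curveRing hf0
  exact ⟨z, hz, hz0, finite_quotient_span_singleton_of_ringKrullDim_eq_one k
    (ringKrullDim_curveRing (mem_maximalIdeal_planeRing.2 hf) hf0) hz hz0⟩

theorem IsPlanarICIS.ne_zero (hf : IsPlanarICIS f) : f ≠ 0 := by
  rintro rfl
  have := hf.isolated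
  have := IsArtinianRing.of_finite k (PlaneRing k ⧸ tjurinaIdeal (0 : PlaneRing k))
  obtain ⟨n, hn⟩ := exists_pow_mem_of_isArtinianRing_quotient (tjurinaIdeal (0 : PlaneRing k))
    (mem_maximalIdeal_planeRing.2 (MvPowerSeries.constantCoeff_X 0))
  simp only [tjurinaIdeal, map_zero, Set.insert_eq_of_mem, Set.mem_singleton_iff,
    Ideal.span_singleton_zero, Ideal.mem_bot] at hn
  exact X_ne_zero_planeRing 0 (eq_zero_of_pow_eq_zero hn)

theorem tjurinaIdeal_le_comap_jacobianIdeal :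
    tjurinaIdeal f ≤ (jacobianIdeal f).comap (Ideal.Quotient.mk (Ideal.span {f})) := by
  rw [tjurinaIdeal, Ideal.span_le]
  rintro _ (rfl | rfl | rfl)
  · rw [SetLike.mem_coe, Ideal.mem_comap, Ideal.Quotient.mk_singleton_self]
    exact zero_mem _
  · exact Ideal.subset_span (Set.mem_insert _ _)
  · exact Ideal.subset_span (Set.mem_insert_of_mem _ rfl)

theorem IsPlanarICIS.finite_quotient_jacobianIdeal (hf : IsPlanarICIS f) :
    Module.Finite k (CurveRing f ⧸ jacobianIdeal f) :=
  have := hf.isolated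
  .of_surjective (Ideal.quotientMapₐ (R₁ := k) (I := tjurinaIdeal f) (jacobianIdeal f)
      (Ideal.Quotient.mkₐ k (Ideal.span {f})) tjurinaIdeal_le_comap_jacobianIdeal).toLinearMap
    (Ideal.quotientMap_surjective (H := tjurinaIdeal_le_comap_jacobianIdeal)
      Ideal.Quotient.mk_surjective)

theorem IsPlanarICIS.exists_hasHilbertSamuelMultiplicity [Infinite k] (hf : IsPlanarICIS f) :
    ∃ h ∈ jacobianIdeal f, Module.Finite k (CurveRing f ⧸ Ideal.span {h}) ∧
      HasHilbertSamuelMultiplicity k (jacobianIdeal f)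
        (Module.finrank k (CurveRing f ⧸ Ideal.span {h}) : ℕ) := by
  have := isLocalRing_curveRing hf.vanishes
  have := hf.finite_quotient_jacobianIdeal
  obtain ⟨z, hz, hz0, _⟩ := exists_parameter_curveRing hf.vanishes hf.ne_zero
  rw [jacobianIdeal] at this ⊢
  exact exists_hasHilbertSamuelMultiplicity_span_pair _ _ hz hz0

theorem mem_nonZeroDivisors_of_finite_quotient (hf : MvPowerSeries.constantCoeff f = 0)
    (hf0 : f ≠ 0) {h : CurveRing f} [Module.Finite k (CurveRing f ⧸ Ideal.span {h})] :
    h ∈ nonZeroDivisors (CurveRing f) := by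
  have := isLocalRing_curveRing hf
  have := IsArtinianRing.of_finite k (CurveRing f ⧸ Ideal.span {h})
  obtain ⟨z, hz, hz0, _⟩ := exists_parameter_curveRing hf hf0
  exact mem_nonZeroDivisors_of_isArtinianRing_quotient hz hz0

theorem IsPlanarICIS.exists_mem_jacobianIdeal_mem_nonZeroDivisors (hf : IsPlanarICIS f) :
    ∃ h ∈ jacobianIdeal f, h ∈ nonZeroDivisors (CurveRing f) := by
  have := isLocalRing_curveRing hf.vanishes
  have := hf.finite_quotient_jacobianIdeal
  have := IsArtinianRing.of_finite k (CurveRing f ⧸ jacobianIdeal f)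
  obtain ⟨z, hz, hz0, -⟩ := exists_parameter_curveRing hf.vanishes hf.ne_zero
  obtain ⟨n, hn⟩ := exists_pow_mem_of_isArtinianRing_quotient (jacobianIdeal f) hz
  exact ⟨z ^ n, hn, pow_mem hz0 n⟩

end PlaneCurves

section Derivations

theorem derivation_eq_of_eqOn {R A M : Type*} [CommRing R] [CommRing A] [Algebra R A]
    [AddCommGroup M] [Module A M] [Module R M] {s : Set A}
    (hs : ∀ x : A, ∃ c : R, x - algebraMap R A c ∈ Ideal.span s) [IsHausdorff (Ideal.span s) M]
    {D₁ D₂ : Derivation R A M} (h : Set.EqOn D₁ D₂ s) : D₁ = D₂ := by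
  have hmem (n : ℕ) (x : A) : (D₁ - D₂) x ∈ (Ideal.span s ^ n • ⊤ : Submodule A M) := by
    induction n generalizing x with
    | zero => simp
    | succ n ih =>
      obtain ⟨c, hc⟩ := hs x
      suffices H : ∀ y ∈ Ideal.span s, (D₁ - D₂) y ∈ (Ideal.span s ^ (n + 1) • ⊤ : Submodule A M) by
        simpa only [map_sub, Derivation.map_algebraMap, sub_zero] using H _ hc
      intro y hy
      induction hy using Submodule.span_induction with
      | mem y hy => simp [h hy]
      | zero => simp
      | add y z _ _ hy hz => rw [map_add]; exact add_mem hy hz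
      | smul b y hy hy' =>
        rw [smul_eq_mul, Derivation.leibniz, pow_succ', mul_smul]
        rw [pow_succ', mul_smul] at hy'
        exact add_mem (Submodule.smul_mem _ _ hy') (Submodule.smul_mem_smul hy (ih b))
  ext x
  exact sub_eq_zero.1 (IsHausdorff.haus ‹_› _ fun n => SModEq.zero.2 (hmem n x))

theorem sub_C_constantCoeff_mem_span_X {R : Type*} [CommRing R] (r : MvPowerSeries (Fin 2) R) :
    r - MvPowerSeries.C (MvPowerSeries.constantCoeff r) ∈
      Ideal.span {MvPowerSeries.X 0, MvPowerSeries.X 1} := by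
  classical
  let g : MvPowerSeries (Fin 2) R := fun m => if m 0 = 0 then MvPowerSeries.coeff m r else 0
  have hg (m) : MvPowerSeries.coeff m g = if m 0 = 0 then MvPowerSeries.coeff m r else 0 := rfl
  have h₀ : MvPowerSeries.X 0 ∣ r - g := MvPowerSeries.X_dvd_iff.2 fun m hm => by
    rw [map_sub, hg, if_pos hm, sub_self]
  have h₁ : MvPowerSeries.X 1 ∣ g - MvPowerSeries.C (MvPowerSeries.constantCoeff r) :=
    MvPowerSeries.X_dvd_iff.2 fun m hm => by
      rw [map_sub, hg, MvPowerSeries.coeff_C]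
      by_cases h0 : m 0 = 0
      · rw [if_pos h0, if_pos (by ext i; fin_cases i <;> assumption)]
        simp [show m = 0 by ext i; fin_cases i <;> assumption]
      · rw [if_neg h0, if_neg (by rintro rfl; exact h0 rfl), sub_zero]
  rw [← sub_add_sub_cancel r g]
  exact add_mem (Ideal.mem_of_dvd _ h₀ (Ideal.subset_span (by simp)))
    (Ideal.mem_of_dvd _ h₁ (Ideal.subset_span (by simp)))

variable {k : Type*} [Field k]

theorem exists_sub_algebraMap_mem_span_powerSeries (b : PowerSeries (PlaneRing k)) :
    ∃ c : k, b - algebraMap k _ c ∈ Ideal.span {PowerSeries.C (MvPowerSeries.X 0),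
      PowerSeries.C (MvPowerSeries.X 1), PowerSeries.X} := by
  refine ⟨MvPowerSeries.constantCoeff (PowerSeries.constantCoeff b), ?_⟩
  have h₀ : PowerSeries.X ∣ b - PowerSeries.C (PowerSeries.constantCoeff b) :=
    PowerSeries.X_dvd_iff.2 (by simp)
  have h₁ := Ideal.mem_map_of_mem PowerSeries.C
    (sub_C_constantCoeff_mem_span_X (PowerSeries.constantCoeff b))
  rw [Ideal.map_span, Set.image_pair, map_sub] at h₁
  rw [PowerSeries.algebraMap_apply, MvPowerSeries.algebraMap_apply, Algebra.algebraMap_self,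
    RingHom.id_apply, ← sub_add_sub_cancel b (PowerSeries.C (PowerSeries.constantCoeff b))]
  refine add_mem (Ideal.mem_of_dvd _ h₀ (Ideal.subset_span (by simp))) (Ideal.span_mono ?_ h₁)
  rintro _ (rfl | rfl) <;> simp

instance isScalarTower_powerSeries_planeRing :
    IsScalarTower k (PowerSeries k) (PowerSeries (PlaneRing k)) :=
  .of_algebraMap_eq fun c => by
    rw [PowerSeries.algebraMap_apply'', PowerSeries.algebraMap_apply (A := k), PowerSeries.map_C,
      PowerSeries.algebraMap_apply, Algebra.algebraMap_self, RingHom.id_apply]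

theorem algebraMap_powerSeries_X :
    algebraMap (PowerSeries k) (PowerSeries (PlaneRing k)) PowerSeries.X = PowerSeries.X := by
  rw [PowerSeries.algebraMap_apply'', PowerSeries.map_X]

theorem fiberDeriv_mul (i : Fin 2) (a b : PowerSeries (PlaneRing k)) :
    fiberDeriv i (a * b) = a * fiberDeriv i b + b * fiberDeriv i a := by
  ext1 n
  rw [mul_comm b, map_add]
  simp only [fiberDeriv, PowerSeries.coeff_mk, PowerSeries.coeff_mul, map_sum, Derivation.leibniz,
    ← Finset.sum_add_distrib]
  exact Finset.sum_congr rfl fun x _ => by simp only [smul_eq_mul]; ring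

theorem fiberDeriv_algebraMap (i : Fin 2) (c : PowerSeries k) :
    fiberDeriv i (algebraMap _ (PowerSeries (PlaneRing k)) c) = 0 := by
  ext1 n
  rw [PowerSeries.algebraMap_apply'', fiberDeriv, PowerSeries.coeff_mk, PowerSeries.coeff_map,
    Derivation.map_algebraMap, map_zero]

theorem fiberDeriv_C (i : Fin 2) (r : PlaneRing k) :
    fiberDeriv i (PowerSeries.C r) = PowerSeries.C (MvPowerSeries.pderiv k i r) := by
  ext1 n
  rw [fiberDeriv, PowerSeries.coeff_mk, PowerSeries.coeff_C, PowerSeries.coeff_C]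
  split_ifs <;> simp

/-- The partial derivatives `∂/∂x` and `∂/∂y` of `k[[x, y]][[t]]` as `k[[t]]`-derivations. -/
def fiberDerivation (i : Fin 2) :
    Derivation (PowerSeries k) (PowerSeries (PlaneRing k)) (PowerSeries (PlaneRing k)) :=
  Derivation.mk'
    { toFun := fiberDeriv i
      map_add' := fun a b => by ext1 n; simp [fiberDeriv]
      map_smul' := fun c a => by
        rw [Algebra.smul_def, fiberDeriv_mul, fiberDeriv_algebraMap, mul_zero, add_zero,
          RingHom.id_apply, Algebra.smul_def] }
    (fiberDeriv_mul i)

theorem fiberDerivation_apply (i : Fin 2) (F : PowerSeries (PlaneRing k)) :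
    fiberDerivation i F = fiberDeriv i F := rfl

theorem fiberDerivation_C_X_self (i : Fin 2) :
    fiberDerivation i (PowerSeries.C (MvPowerSeries.X i : PlaneRing k)) = 1 := by
  rw [fiberDerivation_apply, fiberDeriv_C, MvPowerSeries.pderiv_X_self, map_one]

theorem fiberDerivation_C_X_of_ne {i j : Fin 2} (h : j ≠ i) :
    fiberDerivation i (PowerSeries.C (MvPowerSeries.X j : PlaneRing k)) = 0 := by
  rw [fiberDerivation_apply, fiberDeriv_C, MvPowerSeries.pderiv_X_of_ne h, map_zero]

theorem fiberDerivation_X (i : Fin 2) :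
    fiberDerivation i (PowerSeries.X : PowerSeries (PlaneRing k)) = 0 := by
  rw [← algebraMap_powerSeries_X, Derivation.map_algebraMap]

theorem derivation_powerSeries_apply {M : Type*} [AddCommGroup M]
    [Module (PowerSeries (PlaneRing k)) M] [Module.Finite (PowerSeries (PlaneRing k)) M]
    [Module k M] [IsScalarTower k (PowerSeries (PlaneRing k)) M]
    (D : Derivation k (PowerSeries (PlaneRing k)) M) (b : PowerSeries (PlaneRing k)) :
    D b = fiberDeriv 0 b • D (PowerSeries.C (MvPowerSeries.X 0)) +
      fiberDeriv 1 b • D (PowerSeries.C (MvPowerSeries.X 1)) +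
      PowerSeries.derivative (PlaneRing k) b • D PowerSeries.X := by
  have : IsHausdorff (Ideal.span {PowerSeries.C (MvPowerSeries.X 0 : PlaneRing k),
      PowerSeries.C (MvPowerSeries.X 1), PowerSeries.X}) M :=
    .of_isLocalRing _ _ (ne_top_of_le_ne_top (RingHom.ker_ne_top
      (MvPowerSeries.constantCoeff.comp (PowerSeries.constantCoeff (R := PlaneRing k))))
      (Ideal.span_le.2 (by rintro _ (rfl | rfl | rfl) <;> simp [RingHom.mem_ker])))
  let L (D' : Derivation k (PowerSeries (PlaneRing k)) (PowerSeries (PlaneRing k))) (m : M) :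
      Derivation k (PowerSeries (PlaneRing k)) M := (LinearMap.toSpanSingleton _ M m).compDer D'
  have hD : D = L ((fiberDerivation 0).restrictScalars k) (D (PowerSeries.C (MvPowerSeries.X 0))) +
      L ((fiberDerivation 1).restrictScalars k) (D (PowerSeries.C (MvPowerSeries.X 1))) +
      L ((PowerSeries.derivative (PlaneRing k)).restrictScalars k) (D PowerSeries.X) := by
    refine derivation_eq_of_eqOn exists_sub_algebraMap_mem_span_powerSeries ?_
    rintro _ (rfl | rfl | rfl) <;>
    simp [L, fiberDerivation_C_X_self, fiberDerivation_C_X_of_ne, fiberDerivation_X]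
  exact congr($hD b)

end Derivations

section TotalRing

open IsLocalRing

theorem pow_dvd_of_pow_dvd_mul {A C : Type*} [CommRing A] [CommRing C] (π : A →+* C) {t H : A}
    (hπ : ∀ x, π x = 0 ↔ t ∣ x) (ht : t ∈ nonZeroDivisors A) (hH : π H ∈ nonZeroDivisors C)
    (n : ℕ) (x : A) (h : t ^ n ∣ H * x) : t ^ n ∣ x := by
  induction n generalizing x with
  | zero => simp
  | succ n ih =>
    have h₁ : π H * π x = 0 := by
      rw [← map_mul, hπ]
      exact (dvd_pow_self _ n.succ_ne_zero).trans h
    obtain ⟨y, rfl⟩ := (hπ x).1 (mem_nonZeroDivisors_iff_left.1 hH _ h₁)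
    rw [mul_left_comm, pow_succ', dvd_cancel_left_mem_nonZeroDivisors ht] at h
    rw [pow_succ']
    exact mul_dvd_mul_left _ (ih y h)

variable {k : Type*} [Field k] {f : PlaneRing k} {d : ℕ} {δ : Fin d → PlaneRing k} {a : Fin d → k}

theorem constantCoeff_deformationEq :
    PowerSeries.constantCoeff (deformationEq f δ a) = f := by
  simp [deformationEq]

variable (f δ a) in
/-- The coordinate `t` of the base, as an element of `𝒪_X`. -/
def baseParam : TotalRing f δ a := algebraMap (PowerSeries k) (TotalRing f δ a) PowerSeries.X

theorem baseParam_eq : baseParam f δ a = Ideal.Quotient.mk _ PowerSeries.X := by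
  rw [← algebraMap_powerSeries_X]; rfl

variable (f δ a) in
/-- The restriction `𝒪_X → R / (f)` to the special fibre `t = 0`. -/
def restrictSpecial : TotalRing f δ a →ₐ[k] CurveRing f :=
  { Ideal.Quotient.lift (Ideal.span {deformationEq f δ a})
      ((Ideal.Quotient.mk (Ideal.span {f})).comp PowerSeries.constantCoeff) (fun s hs => by
        obtain ⟨g, rfl⟩ := Ideal.mem_span_singleton.1 hs
        rw [RingHom.comp_apply, map_mul, constantCoeff_deformationEq,
          Ideal.Quotient.eq_zero_iff_mem]
        exact Ideal.mul_mem_right _ _ (Ideal.mem_span_singleton_self _)) with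
    commutes' := fun c => congrArg (Ideal.Quotient.mk (Ideal.span {f}))
      ((congrArg PowerSeries.constantCoeff PowerSeries.algebraMap_apply).trans
        (PowerSeries.constantCoeff_C _)) }

theorem restrictSpecial_mk (s : PowerSeries (PlaneRing k)) :
    restrictSpecial f δ a (Ideal.Quotient.mk _ s) =
      Ideal.Quotient.mk _ (PowerSeries.constantCoeff s) := rfl

variable (f δ a) in
theorem restrictSpecial_surjective : Function.Surjective (restrictSpecial f δ a) := fun r => by
  obtain ⟨r, rfl⟩ := Ideal.Quotient.mk_surjective r
  exact ⟨Ideal.Quotient.mk _ (PowerSeries.C r), by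
    rw [restrictSpecial_mk, PowerSeries.constantCoeff_C]⟩

theorem restrictSpecial_eq_zero_iff {x : TotalRing f δ a} :
    restrictSpecial f δ a x = 0 ↔ baseParam f δ a ∣ x := by
  obtain ⟨s, rfl⟩ := Ideal.Quotient.mk_surjective x
  rw [restrictSpecial_mk, Ideal.Quotient.eq_zero_iff_mem, Ideal.mem_span_singleton, baseParam_eq]
  constructor
  · rintro ⟨g, hg⟩
    obtain ⟨s', hs'⟩ : PowerSeries.X ∣ s - deformationEq f δ a * PowerSeries.C g :=
      PowerSeries.X_dvd_iff.2 (by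
        rw [map_sub, map_mul, constantCoeff_deformationEq, PowerSeries.constantCoeff_C, hg,
          sub_self])
    refine ⟨Ideal.Quotient.mk _ s', ?_⟩
    rw [← map_mul, ← hs', Ideal.Quotient.eq, sub_sub_cancel]
    exact Ideal.mul_mem_right _ _ (Ideal.mem_span_singleton_self _)
  · rintro ⟨y, hy⟩
    obtain ⟨s', rfl⟩ := Ideal.Quotient.mk_surjective y
    have := congr(restrictSpecial f δ a $hy)
    rwa [← map_mul, restrictSpecial_mk, restrictSpecial_mk, map_mul, PowerSeries.constantCoeff_X,
      zero_mul, map_zero, Ideal.Quotient.eq_zero_iff_dvd] at this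

theorem baseParam_mem_nonZeroDivisors (hf : f ≠ 0) :
    baseParam f δ a ∈ nonZeroDivisors (TotalRing f δ a) := by
  refine mem_nonZeroDivisors_iff_left.2 fun x h => ?_
  obtain ⟨s, rfl⟩ := Ideal.Quotient.mk_surjective x
  rw [baseParam_eq, ← map_mul, Ideal.Quotient.eq_zero_iff_dvd] at h
  obtain ⟨g, hg⟩ := h
  have h₀ := congrArg PowerSeries.constantCoeff hg
  rw [map_mul, map_mul, PowerSeries.constantCoeff_X, zero_mul, constantCoeff_deformationEq,
    eq_comm, mul_eq_zero, or_iff_right hf] at h₀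
  obtain ⟨g', rfl⟩ := PowerSeries.X_dvd_iff.2 h₀
  rw [mul_left_comm] at hg
  rw [Ideal.Quotient.eq_zero_iff_dvd, mul_left_cancel₀ PowerSeries.X_ne_zero hg]
  exact dvd_mul_right _ _

theorem deformationEq_mem_maximalIdeal (hf : MvPowerSeries.constantCoeff f = 0) :
    deformationEq f δ a ∈ maximalIdeal (PowerSeries (PlaneRing k)) := by
  rw [mem_maximalIdeal, mem_nonunits_iff, PowerSeries.isUnit_iff_constantCoeff,
    constantCoeff_deformationEq, ← mem_nonunits_iff, ← mem_maximalIdeal]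
  exact mem_maximalIdeal_planeRing.2 hf

theorem isLocalRing_totalRing (hf : MvPowerSeries.constantCoeff f = 0) :
    IsLocalRing (TotalRing f δ a) :=
  isLocalRing_quotient_span_singleton (deformationEq_mem_maximalIdeal hf)

theorem ringKrullDim_totalRing (hf : MvPowerSeries.constantCoeff f = 0) (hf0 : f ≠ 0) :
    ringKrullDim (TotalRing f δ a) = 2 := by
  have hF : deformationEq f δ a ≠ 0 := fun h => hf0 (by
    rw [← constantCoeff_deformationEq (f := f) (δ := δ) (a := a), h, map_zero])
  have h := ringKrullDim_quotient_span_singleton_succ_eq_ringKrullDim_of_mem_nonZeroDivisors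
    (mem_nonZeroDivisors_of_ne_zero hF) (deformationEq_mem_maximalIdeal hf)
  rw [ringKrullDim_powerSeries, ringKrullDim_mvPowerSeries_fin] at h
  exact ENat.WithBot.add_one_cancel.1 h

theorem baseParam_mem_maximalIdeal [IsLocalRing (TotalRing f δ a)]
    (hf : MvPowerSeries.constantCoeff f = 0) :
    baseParam f δ a ∈ maximalIdeal (TotalRing f δ a) := fun h => by
  have := isLocalRing_curveRing hf
  exact (h.map (restrictSpecial f δ a)).ne_zero (restrictSpecial_eq_zero_iff.2 dvd_rfl)

variable (f δ a) in
/-- The subscheme of the special fibre cut out by `I`, seen in `𝒪_X` or in `R / (f)`. -/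
def quotientSpecialEquiv (I : Ideal (TotalRing f δ a)) :
    (TotalRing f δ a ⧸ (specialFiberIdeal f δ a ⊔ I)) ≃ₐ[k]
      CurveRing f ⧸ I.map (restrictSpecial f δ a) := by
  let φ := (Ideal.Quotient.mkₐ k (I.map (restrictSpecial f δ a))).comp (restrictSpecial f δ a)
  have hφ : Function.Surjective φ :=
    Ideal.Quotient.mk_surjective.comp (restrictSpecial_surjective f δ a)
  have hker : specialFiberIdeal f δ a ⊔ I = RingHom.ker φ := by
    have h₁ : RingHom.ker φ = (I.map (restrictSpecial f δ a)).comap (restrictSpecial f δ a) := by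
      ext x
      exact Ideal.Quotient.eq_zero_iff_mem
    rw [h₁, Ideal.comap_map_of_surjective _ (restrictSpecial_surjective f δ a), sup_comm]
    congr 1
    ext x
    exact Ideal.mem_span_singleton.trans restrictSpecial_eq_zero_iff.symm
  exact (Ideal.quotientEquivAlgOfEq k hker).trans (Ideal.quotientKerAlgEquivOfSurjective hφ)

theorem vdim_eq_finrank {K V : Type*} [Field K] [AddCommGroup V] [Module K V]
    [FiniteDimensional K V] : vdim K V = Module.finrank K V := by
  rw [vdim, ← Module.finrank_eq_rank, map_natCast]

theorem finiteDimensional_of_vdim_eq_natCast {K V : Type*} [Field K] [AddCommGroup V] [Module K V]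
    {n : ℕ} (h : vdim K V = n) : FiniteDimensional K V :=
  Module.rank_lt_aleph0_iff.1 (Cardinal.toENat_lt_top.1 (h.trans_lt (ENat.natCast_lt_top n)))

theorem specialMultiplicity_span_singleton (x : TotalRing f δ a) :
    specialMultiplicity f δ a (Ideal.span {x}) =
      vdim k (CurveRing f ⧸ Ideal.span {restrictSpecial f δ a x}) := by
  rw [specialMultiplicity, vdim, vdim, (quotientSpecialEquiv f δ a _).toLinearEquiv.rank_eq,
    Ideal.map_span, Set.image_singleton]

variable (f δ a) in
/-- The partial derivative `∂F/∂x` or `∂F/∂y` of the equation of `X`, as an element of `𝒪_X`. -/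
def eqDeriv (i : Fin 2) : TotalRing f δ a :=
  Ideal.Quotient.mk _ (fiberDeriv i (deformationEq f δ a))

theorem singIdeal_eq : singIdeal f δ a = Ideal.span {eqDeriv f δ a 0, eqDeriv f δ a 1} := rfl

theorem restrictSpecial_eqDeriv (i : Fin 2) :
    restrictSpecial f δ a (eqDeriv f δ a i) = Ideal.Quotient.mk _ (MvPowerSeries.pderiv k i f) := by
  rw [eqDeriv, restrictSpecial_mk, ← PowerSeries.coeff_zero_eq_constantCoeff_apply, fiberDeriv,
    PowerSeries.coeff_mk, PowerSeries.coeff_zero_eq_constantCoeff_apply,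
    constantCoeff_deformationEq]

theorem map_singIdeal : (singIdeal f δ a).map (restrictSpecial f δ a) = jacobianIdeal f := by
  rw [singIdeal_eq, Ideal.map_span, Set.image_pair, restrictSpecial_eqDeriv,
    restrictSpecial_eqDeriv]
  rfl

theorem exists_restrictSpecial_eq {h : CurveRing f} (hh : h ∈ jacobianIdeal f) :
    ∃ H ∈ singIdeal f δ a, restrictSpecial f δ a H = h := by
  rwa [← map_singIdeal (δ := δ) (a := a),
    Ideal.mem_map_iff_of_surjective _ (restrictSpecial_surjective f δ a)] at hh

theorem IsAdmissible.exists_baseParam_pow_mem (hf : IsPlanarICIS f) (ha : IsAdmissible f δ a) :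
    ∃ n, baseParam f δ a ^ n ∈ singIdeal f δ a := by
  have := isLocalRing_totalRing (δ := δ) (a := a) hf.vanishes
  refine maximalIdeal_le_radical_of_ringKrullDim_le_height ?_
    (baseParam_mem_maximalIdeal hf.vanishes)
  rw [ringKrullDim_totalRing hf.vanishes hf.ne_zero]
  exact WithBot.coe_le_coe.2 ha

theorem IsAdmissible.eq_zero_of_mul_eqDeriv (hf : IsPlanarICIS f) (ha : IsAdmissible f δ a)
    {c : TotalRing f δ a} (hc : ∀ i, c * eqDeriv f δ a i = 0) : c = 0 := by
  obtain ⟨n, hn⟩ := ha.exists_baseParam_pow_mem hf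
  obtain ⟨x, y, hxy⟩ := Ideal.mem_span_pair.1 (singIdeal_eq (f := f) ▸ hn)
  refine (mul_right_mem_nonZeroDivisors_eq_zero_iff
    (pow_mem (baseParam_mem_nonZeroDivisors hf.ne_zero) n)).1 (?_ : c * baseParam f δ a ^ n = 0)
  rw [← hxy]
  linear_combination x * hc 0 + y * hc 1

theorem IsAdmissible.exists_eq_mul_eqDeriv (hf : IsPlanarICIS f) (ha : IsAdmissible f δ a)
    {α β : TotalRing f δ a} (h : α * eqDeriv f δ a 0 + β * eqDeriv f δ a 1 = 0) :
    ∃ c, α = c * eqDeriv f δ a 1 ∧ β = -(c * eqDeriv f δ a 0) := by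
  obtain ⟨n, hn⟩ := ha.exists_baseParam_pow_mem hf
  obtain ⟨g, hg, hg0⟩ := hf.exists_mem_jacobianIdeal_mem_nonZeroDivisors
  obtain ⟨H, hH, rfl⟩ := exists_restrictSpecial_eq (δ := δ) (a := a) hg
  have ht : baseParam f δ a ∈ nonZeroDivisors _ := baseParam_mem_nonZeroDivisors hf.ne_zero
  exact exists_eq_mul_of_mul_add_mul_eq_zero hn hH (pow_mem ht n)
    (pow_dvd_of_pow_dvd_mul (restrictSpecial f δ a : TotalRing f δ a →+* CurveRing f)
      (fun _ => restrictSpecial_eq_zero_iff) ht hg0 n) h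

end TotalRing

section PrincipalPartsDual

variable (B O : Type*) [CommRing B] [CommRing O] [Algebra B O]

variable {O} in
/-- The functional on the `O`-algebra `T / I` induced by a functional on `T` that kills `I`. -/
def liftQuotient {T : Type*} [CommRing T] [Algebra O T] (I : Ideal T) (L : T →ₗ[O] O)
    (h : ∀ x ∈ I, L x = 0) : Module.Dual O (T ⧸ I) :=
  Submodule.liftQ (I.restrictScalars O) L h

/-- The functional `a ⊗ b ↦ a * b` on principal parts of order two. -/
def mulFunctional : Module.Dual O ((O ⊗[B] O) ⧸ KaehlerDifferential.ideal B O ^ 2) :=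
  liftQuotient _ (Algebra.TensorProduct.lmul'' B (S := O)).toLinearMap fun x hx =>
    show x ∈ KaehlerDifferential.ideal B O from Ideal.pow_le_self two_ne_zero hx

variable {B O}

theorem mulFunctional_tmul (a b : O) :
    mulFunctional B O (Ideal.Quotient.mk _ (a ⊗ₜ b)) = a * b := rfl

/-- The functional `a ⊗ b ↦ a * D b` on principal parts of order two. -/
def derivationFunctional (D : Derivation B O O) :
    Module.Dual O ((O ⊗[B] O) ⧸ KaehlerDifferential.ideal B O ^ 2) :=
  liftQuotient _ D.tensorProductTo fun x hx => by
    rw [pow_two] at hx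
    refine Submodule.mul_induction_on hx (fun y hy z hz => ?_) fun y z hy hz => by
      rw [map_add, hy, hz, add_zero]
    rw [Derivation.tensorProductTo_mul, RingHom.mem_ker.1 hy, RingHom.mem_ker.1 hz, zero_smul,
      zero_smul, add_zero]

theorem derivationFunctional_tmul (D : Derivation B O O) (a b : O) :
    derivationFunctional D (Ideal.Quotient.mk _ (a ⊗ₜ b)) = a * D b := rfl

theorem functional_ext {φ ψ : Module.Dual O ((O ⊗[B] O) ⧸ KaehlerDifferential.ideal B O ^ 2)}
    (h : ∀ b, φ (Ideal.Quotient.mk _ (1 ⊗ₜ b)) = ψ (Ideal.Quotient.mk _ (1 ⊗ₜ b))) : φ = ψ := by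
  refine LinearMap.ext fun x => ?_
  obtain ⟨x, rfl⟩ := Ideal.Quotient.mk_surjective x
  induction x using TensorProduct.induction_on with
  | zero => rw [map_zero, map_zero, map_zero]
  | add x y hx hy => rw [map_add, map_add, map_add, hx, hy]
  | tmul a b =>
    have hab : Ideal.Quotient.mk (KaehlerDifferential.ideal B O ^ 2) (a ⊗ₜ b) =
        a • Ideal.Quotient.mk (KaehlerDifferential.ideal B O ^ 2) (1 ⊗ₜ[B] b) := by
      rw [← Ideal.Quotient.mkₐ_eq_mk O, ← map_smul, TensorProduct.smul_tmul', smul_eq_mul, mul_one]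
    rw [hab, map_smul, map_smul, h]

/-- The derivation `b ↦ φ (1 ⊗ b - b ⊗ 1)` attached to a functional `φ` on principal parts of
order two: the restriction of `φ` to the differentials `I_Δ / I_Δ ^ 2`. -/
def functionalDerivation
    (φ : Module.Dual O ((O ⊗[B] O) ⧸ KaehlerDifferential.ideal B O ^ 2)) : Derivation B O O :=
  let ι : Ω[O⁄B] →ₗ[O ⊗[B] O] (O ⊗[B] O) ⧸ KaehlerDifferential.ideal B O ^ 2 :=
    Ideal.cotangentToQuotientSquare _
  (φ ∘ₗ ι.restrictScalars O).compDer (KaehlerDifferential.D B O)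

theorem functionalDerivation_apply
    (φ : Module.Dual O ((O ⊗[B] O) ⧸ KaehlerDifferential.ideal B O ^ 2)) (b : O) :
    functionalDerivation φ b = φ (Ideal.Quotient.mk _ (1 ⊗ₜ b - b ⊗ₜ 1)) := rfl

theorem functional_eq_smul_mulFunctional_add_derivationFunctional
    (φ : Module.Dual O ((O ⊗[B] O) ⧸ KaehlerDifferential.ideal B O ^ 2)) :
    φ = φ 1 • mulFunctional B O + derivationFunctional (functionalDerivation φ) := by
  refine functional_ext fun b => ?_
  have hb : Ideal.Quotient.mk (KaehlerDifferential.ideal B O ^ 2) (b ⊗ₜ 1) =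
      b • (1 : (O ⊗[B] O) ⧸ KaehlerDifferential.ideal B O ^ 2) := by
    rw [← map_one (Ideal.Quotient.mkₐ O _), ← map_smul, Algebra.TensorProduct.one_def,
      TensorProduct.smul_tmul', smul_eq_mul, mul_one, Ideal.Quotient.mkₐ_eq_mk]
  rw [LinearMap.add_apply, LinearMap.smul_apply, mulFunctional_tmul, derivationFunctional_tmul,
    functionalDerivation_apply, map_sub, map_sub, hb, map_smul, smul_eq_mul, smul_eq_mul]
  ring

theorem derivationFunctional_smul (c : O) (D : Derivation B O O) :
    derivationFunctional (c • D) = c • derivationFunctional D :=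
  functional_ext fun b => by
    rw [LinearMap.smul_apply, derivationFunctional_tmul, derivationFunctional_tmul,
      Derivation.smul_apply, one_mul, one_mul]

theorem derivationFunctional_mem {I : Ideal O} {D : Derivation B O O} (hD : ∀ b, D b ∈ I)
    (x : (O ⊗[B] O) ⧸ KaehlerDifferential.ideal B O ^ 2) : derivationFunctional D x ∈ I := by
  obtain ⟨x, rfl⟩ := Ideal.Quotient.mk_surjective x
  induction x using TensorProduct.induction_on with
  | zero => rw [map_zero, map_zero]; exact zero_mem _
  | add x y hx hy => rw [map_add, map_add]; exact add_mem hx hy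
  | tmul x y => exact Ideal.mul_mem_left _ _ (hD y)

end PrincipalPartsDual

section Hamiltonian

variable {k : Type*} [Field k] {f : PlaneRing k} {d : ℕ} {δ : Fin d → PlaneRing k} {a : Fin d → k}

theorem mk_hamiltonian_eq_zero {x : PowerSeries (PlaneRing k)}
    (hx : Ideal.Quotient.mkₐ (PowerSeries k) (Ideal.span {deformationEq f δ a}) x = 0) :
    Ideal.Quotient.mkₐ (PowerSeries k) (Ideal.span {deformationEq f δ a})
      ((fiberDeriv 1 (deformationEq f δ a) • fiberDerivation 0 -
        fiberDeriv 0 (deformationEq f δ a) • fiberDerivation 1 :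
          Derivation (PowerSeries k) _ _) x) = 0 := by
  obtain ⟨g, rfl⟩ := Ideal.mem_span_singleton.1 (Ideal.Quotient.eq_zero_iff_mem.1 hx)
  refine Ideal.Quotient.eq_zero_iff_mem.2 (Ideal.mem_span_singleton.2
    ⟨fiberDeriv 1 (deformationEq f δ a) * fiberDeriv 0 g -
      fiberDeriv 0 (deformationEq f δ a) * fiberDeriv 1 g, ?_⟩)
  simp only [Derivation.leibniz, Derivation.sub_apply, Derivation.smul_apply, smul_eq_mul,
    fiberDerivation_apply]
  ring

variable (f δ a) in
/-- The derivation `F_y ∂_x - F_x ∂_y` of `𝒪_X` over the base. -/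
def hamiltonian : Derivation (PowerSeries k) (TotalRing f δ a) (TotalRing f δ a) :=
  Derivation.liftOfSurjective
    (f := Ideal.Quotient.mkₐ (PowerSeries k) (Ideal.span {deformationEq f δ a}))
    Ideal.Quotient.mk_surjective fun _ => mk_hamiltonian_eq_zero

theorem hamiltonian_mk (b : PowerSeries (PlaneRing k)) :
    hamiltonian f δ a (Ideal.Quotient.mk _ b) =
      eqDeriv f δ a 1 * Ideal.Quotient.mk _ (fiberDeriv 0 b) -
        eqDeriv f δ a 0 * Ideal.Quotient.mk _ (fiberDeriv 1 b) := by
  refine (Derivation.liftOfSurjective_apply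
    (f := Ideal.Quotient.mkₐ (PowerSeries k) (Ideal.span {deformationEq f δ a}))
    Ideal.Quotient.mk_surjective (fun _ => mk_hamiltonian_eq_zero) b).trans ?_
  rw [eqDeriv, eqDeriv, ← map_mul, ← map_mul, ← map_sub]
  rfl

theorem hamiltonian_mem (x : TotalRing f δ a) : hamiltonian f δ a x ∈ singIdeal f δ a := by
  obtain ⟨b, rfl⟩ := Ideal.Quotient.mk_surjective x
  rw [hamiltonian_mk, singIdeal_eq]
  exact sub_mem (Ideal.mul_mem_right _ _ (Ideal.subset_span (by simp)))
    (Ideal.mul_mem_right _ _ (Ideal.subset_span (by simp)))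

variable (f δ a) in
/-- The coordinates `x` and `y` in `𝒪_X`. -/
def coord (i : Fin 2) : TotalRing f δ a :=
  Ideal.Quotient.mk _ (PowerSeries.C (MvPowerSeries.X i))

theorem hamiltonian_coord_zero : hamiltonian f δ a (coord f δ a 0) = eqDeriv f δ a 1 := by
  rw [coord, hamiltonian_mk, ← fiberDerivation_apply, ← fiberDerivation_apply,
    fiberDerivation_C_X_self, fiberDerivation_C_X_of_ne (by decide), map_one, map_zero, mul_one,
    mul_zero, sub_zero]

theorem hamiltonian_coord_one : hamiltonian f δ a (coord f δ a 1) = -eqDeriv f δ a 0 := by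
  rw [coord, hamiltonian_mk, ← fiberDerivation_apply, ← fiberDerivation_apply,
    fiberDerivation_C_X_self, fiberDerivation_C_X_of_ne (by decide), map_one, map_zero, mul_one,
    mul_zero, zero_sub]

theorem derivation_totalRing_mk
    (D : Derivation (PowerSeries k) (TotalRing f δ a) (TotalRing f δ a))
    (b : PowerSeries (PlaneRing k)) :
    D (Ideal.Quotient.mk _ b) = Ideal.Quotient.mk _ (fiberDeriv 0 b) * D (coord f δ a 0) +
      Ideal.Quotient.mk _ (fiberDeriv 1 b) * D (coord f δ a 1) := by
  have h := derivation_powerSeries_apply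
    ((D.compAlgebraMap (PowerSeries (PlaneRing k))).restrictScalars k) b
  have ht : D (Ideal.Quotient.mk _ PowerSeries.X) = 0 := by
    rw [← baseParam_eq, baseParam, Derivation.map_algebraMap]
  refine h.trans ?_
  simp only [Derivation.restrictScalars_apply, Derivation.compAlgebraMap_apply,
    Ideal.Quotient.algebraMap_eq, ht, smul_zero, add_zero]
  rfl

theorem IsAdmissible.exists_smul_hamiltonian (hf : IsPlanarICIS f) (ha : IsAdmissible f δ a)
    (D : Derivation (PowerSeries k) (TotalRing f δ a) (TotalRing f δ a)) :
    ∃ c : TotalRing f δ a, D = c • hamiltonian f δ a := by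
  have h₀ := derivation_totalRing_mk D (deformationEq f δ a)
  rw [Ideal.Quotient.eq_zero_iff_mem.2 (Ideal.mem_span_singleton_self _), map_zero] at h₀
  obtain ⟨c, hx, hy⟩ := ha.exists_eq_mul_eqDeriv hf (α := D (coord f δ a 0))
    (β := D (coord f δ a 1)) (by rw [eqDeriv, eqDeriv]; linear_combination -h₀)
  refine ⟨c, Derivation.ext fun x => ?_⟩
  obtain ⟨b, rfl⟩ := Ideal.Quotient.mk_surjective x
  rw [derivation_totalRing_mk, hx, hy, Derivation.smul_apply, hamiltonian_mk, smul_eq_mul]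
  ring

theorem IsAdmissible.linearIndependent_dual (hf : IsPlanarICIS f) (ha : IsAdmissible f δ a) :
    LinearIndependent (TotalRing f δ a) ![mulFunctional (PowerSeries k) (TotalRing f δ a),
      derivationFunctional (hamiltonian f δ a)] := by
  refine LinearIndependent.pair_iff.2 fun s t h => ?_
  have hst (b) : s * b + t * hamiltonian f δ a b = 0 := by
    have := LinearMap.congr_fun h (Ideal.Quotient.mk _ (1 ⊗ₜ b))
    rwa [LinearMap.add_apply, LinearMap.smul_apply, LinearMap.smul_apply, mulFunctional_tmul,
      derivationFunctional_tmul, one_mul, one_mul] at this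
  obtain rfl : s = 0 := by
    simpa only [Derivation.map_one_eq_zero, mul_zero, add_zero, mul_one] using hst 1
  refine ⟨rfl, ha.eq_zero_of_mul_eqDeriv hf (Fin.forall_fin_two.2 ⟨?_, ?_⟩)⟩
  · have := hst (coord f δ a 1)
    rw [hamiltonian_coord_one] at this
    linear_combination -this
  · have := hst (coord f δ a 0)
    rwa [hamiltonian_coord_zero, zero_mul, zero_add] at this

theorem IsAdmissible.span_dual (hf : IsPlanarICIS f) (ha : IsAdmissible f δ a) :
    ⊤ ≤ Submodule.span (TotalRing f δ a)
      (Set.range ![mulFunctional (PowerSeries k) (TotalRing f δ a),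
        derivationFunctional (hamiltonian f δ a)]) := fun φ _ => by
  obtain ⟨c, hc⟩ := ha.exists_smul_hamiltonian hf (functionalDerivation φ)
  rw [Matrix.range_cons_cons_empty, Submodule.mem_span_pair]
  exact ⟨φ 1, c, by
    rw [← derivationFunctional_smul, ← hc,
      ← functional_eq_smul_mulFunctional_add_derivationFunctional]⟩

/-- For an admissible deformation, the dual of the module of principal parts of order two is free
on the multiplication and the Hamiltonian derivation. -/
def dualBasis (hf : IsPlanarICIS f) (ha : IsAdmissible f δ a) :
    Module.Basis (Fin 2) (TotalRing f δ a)
      (Module.Dual (TotalRing f δ a) (PrincipalParts f δ a 2)) :=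
  Module.Basis.mk (ha.linearIndependent_dual hf) (ha.span_dual hf)

theorem dualBasis_zero (hf : IsPlanarICIS f) (ha : IsAdmissible f δ a) :
    dualBasis hf ha 0 = mulFunctional (PowerSeries k) (TotalRing f δ a) := by
  rw [dualBasis, Module.Basis.mk_apply, Matrix.cons_val_zero]

theorem dualBasis_one (hf : IsPlanarICIS f) (ha : IsAdmissible f δ a) :
    dualBasis hf ha 1 = derivationFunctional (hamiltonian f δ a) := by
  rw [dualBasis, Module.Basis.mk_apply, Matrix.cons_val_one, Matrix.cons_val_fin_one]

theorem degeneracyIdeal_eq_of_basis {m : ℕ}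
    (b e : Module.Basis (Fin m) (TotalRing f δ a)
      (Module.Dual (TotalRing f δ a) (PrincipalParts f δ a m)))
    (τ : Fin m → PrincipalParts f δ a m) :
    degeneracyIdeal f δ a e τ = degeneracyIdeal f δ a b τ := by
  have h : (Matrix.of fun i j => e i (τ j)) =
      (b.toMatrix e).transpose * Matrix.of fun i j => b i (τ j) := by
    ext i j
    conv_lhs => rw [Matrix.of_apply, ← b.sum_repr (e i)]
    rw [Matrix.mul_apply, LinearMap.sum_apply]
    rfl
  have := b.invertibleToMatrix e
  rw [degeneracyIdeal, degeneracyIdeal, h, Matrix.det_mul, Matrix.det_transpose,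
    Ideal.span_singleton_mul_left_unit (Matrix.isUnit_det_of_invertible _)]

theorem IsAdmissible.exists_degeneracyIdeal_eq (hf : IsPlanarICIS f) (ha : IsAdmissible f δ a)
    (e : Module.Basis (Fin 2) (TotalRing f δ a)
      (Module.Dual (TotalRing f δ a) (PrincipalParts f δ a 2)))
    (τ : Fin 2 → PrincipalParts f δ a 2) :
    ∃ h ∈ singIdeal f δ a, degeneracyIdeal f δ a e τ = Ideal.span {h} := by
  rw [degeneracyIdeal_eq_of_basis (dualBasis hf ha)]
  refine ⟨_, ?_, rfl⟩
  rw [Matrix.det_fin_two]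
  simp only [Matrix.of_apply, dualBasis_zero, dualBasis_one]
  exact sub_mem (Ideal.mul_mem_left _ _ (derivationFunctional_mem hamiltonian_mem _))
    (Ideal.mul_mem_left _ _ (derivationFunctional_mem hamiltonian_mem _))

theorem IsAdmissible.exists_degeneracyIdeal_eq_span (hf : IsPlanarICIS f)
    (ha : IsAdmissible f δ a)
    (e : Module.Basis (Fin 2) (TotalRing f δ a)
      (Module.Dual (TotalRing f δ a) (PrincipalParts f δ a 2)))
    {h : TotalRing f δ a} (hh : h ∈ singIdeal f δ a) :
    ∃ τ : Fin 2 → PrincipalParts f δ a 2, degeneracyIdeal f δ a e τ = Ideal.span {h} := by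
  rw [singIdeal_eq] at hh
  obtain ⟨α, β, rfl⟩ := Ideal.mem_span_pair.1 hh
  refine ⟨![Ideal.Quotient.mk _ (1 ⊗ₜ 1), Ideal.Quotient.mk _ (β ⊗ₜ coord f δ a 0 -
    α ⊗ₜ coord f δ a 1)], ?_⟩
  rw [degeneracyIdeal_eq_of_basis (dualBasis hf ha), degeneracyIdeal, Matrix.det_fin_two]
  congr 2
  simp only [Matrix.of_apply, dualBasis_zero, dualBasis_one,
    Matrix.cons_val_zero, Matrix.cons_val_one, map_sub, mulFunctional_tmul,
    derivationFunctional_tmul, Derivation.map_one_eq_zero, hamiltonian_coord_zero,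
    hamiltonian_coord_one]
  ring

end Hamiltonian

section ExtendDerivation

theorem exists_derivation_extends_of_formallyEtale {k B L : Type*} [CommRing k] [CommRing B]
    [CommRing L] [Algebra k B] [Algebra k L] [Algebra B L] [IsScalarTower k B L]
    [Algebra.FormallyEtale B L] (D₀ : Derivation k B L) :
    ∃ D : Derivation k L L, ∀ b, D (algebraMap B L b) = D₀ b := by
  refine ⟨((D₀.liftKaehlerDifferential.liftBaseChange L).comp
    (KaehlerDifferential.tensorKaehlerEquivOfFormallyEtale k B L).symm.toLinearMap).compDer
    (KaehlerDifferential.D k L), fun b => ?_⟩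
  simp [KaehlerDifferential.tensorKaehlerEquivOfFormallyEtale_symm_D_algebraMap]

theorem exists_derivation_of_forall_mem_range {k A M N : Type*} [CommRing k] [CommRing A]
    [Algebra k A] [AddCommGroup M] [Module A M] [Module k M] [AddCommGroup N] [Module A N]
    [Module k N] [IsScalarTower k A M] [IsScalarTower k A N] {ι : N →ₗ[A] M}
    (hι : Function.Injective ι) {E : Derivation k A M} (hE : ∀ x, E x ∈ LinearMap.range ι) :
    ∃ D : Derivation k A N, ∀ x, ι (D x) = E x := by
  choose g hg using hE
  refine ⟨.mk' ⟨⟨g, fun x y => hι ?_⟩, fun c x => hι ?_⟩ fun x y => hι ?_, hg⟩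
  · simp only [map_add, hg]
  · simp only [RingHom.id_apply, hg, Derivation.map_smul, LinearMap.map_smul_of_tower]
  · simp only [LinearMap.coe_mk, AddHom.coe_mk, map_add, map_smul, hg, Derivation.leibniz]

variable {k B : Type*} (A : Type*) [CommRing k] [CommRing B] [CommRing A] [IsDomain B] [IsDomain A]
  [CharZero B] [Algebra k B] [Algebra k A] [Algebra B A] [IsScalarTower k B A]
  [FaithfulSMul B A]

theorem exists_derivation_fractionRing_extends [Algebra.IsIntegral B A] (D₀ : Derivation k B B) :
    ∃ D : Derivation k (FractionRing A) (FractionRing A),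
      ∀ b, D (algebraMap B _ b) = algebraMap B _ (D₀ b) := by
  let K := FractionRing B
  let L := FractionRing A
  let _ : Algebra K L := FractionRing.liftAlgebra B L
  have : IsScalarTower B K L := FractionRing.isScalarTower_liftAlgebra B L
  have : CharZero K := charZero_of_injective_algebraMap (IsFractionRing.injective B K)
  have : Algebra.IsAlgebraic B L := (IsFractionRing.isAlgebraic_iff' B A L).1 inferInstance
  have : Algebra.IsAlgebraic K L := ⟨fun _ => (IsFractionRing.isAlgebraic_iff B K L).1
    (Algebra.IsAlgebraic.isAlgebraic _)⟩
  have : Algebra.FormallyEtale K L := .of_isSeparable K L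
  have : Algebra.FormallyEtale B K := .of_isLocalization (nonZeroDivisors B)
  have : Algebra.FormallyEtale B L := .comp B K L
  have : IsScalarTower k B L := .to₁₂₄ k B A L
  exact exists_derivation_extends_of_formallyEtale ((Algebra.linearMap B L).compDer D₀)

theorem exists_derivation_extends_up_to_denominator [Module.Finite B A] (D₀ : Derivation k B B) :
    ∃ c : A, c ≠ 0 ∧ ∃ D : Derivation k A A,
      ∀ b, D (algebraMap B A b) = c * algebraMap B A (D₀ b) := by
  let L := FractionRing A
  obtain ⟨D₁, hD₁⟩ := exists_derivation_fractionRing_extends A D₀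
  obtain ⟨s, hs⟩ := Module.Finite.fg_top (R := B) (M := A)
  classical
  obtain ⟨c, hc⟩ := IsLocalization.exist_integer_multiples (nonZeroDivisors A) s
    fun x => D₁ (algebraMap A L x)
  let E : Derivation k A L := (c : A) • (D₁.compAlgebraMap A)
  have hE_algebraMap (b : B) :
      E (algebraMap B A b) = algebraMap A L (c * algebraMap B A (D₀ b)) := by
    rw [map_mul, ← IsScalarTower.algebraMap_apply, ← hD₁, ← Algebra.smul_def,
      IsScalarTower.algebraMap_apply B A L]
    rfl
  have hE (x : A) : E x ∈ LinearMap.range (Algebra.linearMap A L) := by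
    have hx : x ∈ Submodule.span B (s : Set A) := hs ▸ Submodule.mem_top
    induction hx using Submodule.span_induction with
    | mem x hx => exact hc x hx
    | zero => exact map_zero E ▸ zero_mem _
    | add x y _ _ hx hy => exact map_add E x y ▸ add_mem hx hy
    | smul b x _ hx =>
      rw [Algebra.smul_def, Derivation.leibniz, hE_algebraMap]
      exact add_mem (Submodule.smul_mem _ _ hx) (Submodule.smul_mem _ _ ⟨_, rfl⟩)
  have hinj : Function.Injective (Algebra.linearMap A L) := IsFractionRing.injective A L
  obtain ⟨D, hD⟩ := exists_derivation_of_forall_mem_range hinj hE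
  exact ⟨c, nonZeroDivisors.coe_ne_zero c, D, fun b => hinj ((hD _).trans (hE_algebraMap b))⟩

end ExtendDerivation

section PowerSeriesAlgebras

open PowerSeries IsLocalRing

variable (k : Type*) [Field k] {O : Type*} [CommRing O] [Algebra k O] [Algebra k⟦X⟧ O]
  [IsScalarTower k k⟦X⟧ O]

/-- The fibre over `t = 0` of the subscheme cut out by `I`. -/
def quotientBaseEquiv (I : Ideal O) :
    ((O ⧸ I) ⧸ Ideal.span {algebraMap k⟦X⟧ (O ⧸ I) X}) ≃ₐ[k]
      O ⧸ (Ideal.span {algebraMap k⟦X⟧ O X} ⊔ I) :=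
  ((Ideal.quotientEquivAlgOfEq k (by
    rw [Ideal.map_span, Set.image_singleton]; rfl)).trans
    (DoubleQuot.quotQuotEquivQuotSupₐ k I (Ideal.span {algebraMap k⟦X⟧ O X}))).trans
    (Ideal.quotientEquivAlgOfEq k (sup_comm _ _))

theorem finite_powerSeries_quotient [IsLocalRing O] [IsNoetherianRing O]
    (hX : algebraMap k⟦X⟧ O X ∈ maximalIdeal O) (I : Ideal O)
    [Module.Finite k (O ⧸ (Ideal.span {algebraMap k⟦X⟧ O X} ⊔ I))] :
    Module.Finite k⟦X⟧ (O ⧸ I) := by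
  have : IsHausdorff (Ideal.span {(X : k⟦X⟧)}) (O ⧸ I) := by
    rw [← IsHausdorff.map_algebraMap_iff (S := O), Ideal.map_span, Set.image_singleton]
    exact .of_isLocalRing _ _ fun h => hX (Ideal.span_singleton_eq_top.1 h)
  have hmap : (Ideal.span {(X : k⟦X⟧)} • ⊤ : Submodule k⟦X⟧ (O ⧸ I)) =
      (Ideal.span {algebraMap k⟦X⟧ (O ⧸ I) X}).restrictScalars k⟦X⟧ := by
    rw [Ideal.smul_top_eq_map, Ideal.map_span, Set.image_singleton]
  have : Module.Finite k ((O ⧸ I) ⧸ (Ideal.span {(X : k⟦X⟧)} • ⊤ : Submodule k⟦X⟧ (O ⧸ I))) := by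
    rw [hmap]
    exact .equiv (quotientBaseEquiv k I).symm.toLinearEquiv
  have : Module.Finite k⟦X⟧ ((O ⧸ I) ⧸ (Ideal.span {(X : k⟦X⟧)} • ⊤ : Submodule k⟦X⟧ (O ⧸ I))) :=
    .of_restrictScalars_finite k _ _
  exact finite_of_finite_quotient_smul_top (Ideal.span {X}) _

theorem finrank_powerSeries_quotient {I : Ideal O} [Module.Finite k⟦X⟧ (O ⧸ I)]
    [Module.Free k⟦X⟧ (O ⧸ I)] : Module.finrank k⟦X⟧ (O ⧸ I) =
      Module.finrank k (O ⧸ (Ideal.span {algebraMap k⟦X⟧ O X} ⊔ I)) := by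
  rw [← finrank_quotient_span_X (k := k), (quotientBaseEquiv k I).toLinearEquiv.finrank_eq]

theorem exists_derivation_algebraMap_X_ne_zero [CharZero k] [IsDomain O] [Module.Finite k⟦X⟧ O]
    (hX : algebraMap k⟦X⟧ O X ≠ 0) : ∃ D : Derivation k O O, D (algebraMap k⟦X⟧ O X) ≠ 0 := by
  have : Module.IsTorsionFree k⟦X⟧ O :=
    isTorsionFree_of_irreducible_smul X_irreducible fun x hx => by
      rw [Algebra.smul_def, mul_eq_zero] at hx
      exact hx.resolve_left hX
  have : CharZero k⟦X⟧ := charZero_of_injective_algebraMap (R := k) C_injective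
  obtain ⟨c, hc, D, hD⟩ := exists_derivation_extends_up_to_denominator O (derivative k)
  refine ⟨D, ?_⟩
  rwa [hD, derivative_X, map_one, mul_one]

end PowerSeriesAlgebras

section GenericDeformation

open IsLocalRing

variable {k : Type*} [Field k] {f : PlaneRing k} {d : ℕ} {δ : Fin d → PlaneRing k} {a : Fin d → k}

theorem derivative_deformationEq : PowerSeries.derivative (PlaneRing k) (deformationEq f δ a) =
    PowerSeries.C (∑ i, a i • δ i) := by
  have hC (r : PlaneRing k) : PowerSeries.derivative (PlaneRing k) (PowerSeries.C r) = 0 :=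
    Derivation.map_algebraMap _ r
  rw [deformationEq, map_add, Derivation.leibniz, hC, hC, PowerSeries.derivative_X, smul_zero,
    zero_add, zero_add, smul_eq_mul, mul_one]

/-- Applying a derivation to `F = 0` gives `F_x dx + F_y dy + F_t dt = 0`. -/
theorem derivation_algebraMap_powerSeries_X_eq_zero {A : Type*} [CommRing A] [Algebra k A]
    [Algebra (PowerSeries (PlaneRing k)) A] [IsScalarTower k (PowerSeries (PlaneRing k)) A]
    [Module.Finite (PowerSeries (PlaneRing k)) A] {F : PowerSeries (PlaneRing k)}
    (hF : algebraMap (PowerSeries (PlaneRing k)) A F = 0)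
    (hF_fiber : ∀ i, algebraMap (PowerSeries (PlaneRing k)) A (fiberDeriv i F) = 0)
    (hF_t : IsUnit (PowerSeries.derivative (PlaneRing k) F)) (D : Derivation k A A) :
    D (algebraMap (PowerSeries (PlaneRing k)) A PowerSeries.X) = 0 := by
  have h := derivation_powerSeries_apply (D.compAlgebraMap (PowerSeries (PlaneRing k))) F
  rw [Derivation.compAlgebraMap_apply, hF, map_zero, algebra_compatible_smul A (fiberDeriv 0 F),
    algebra_compatible_smul A (fiberDeriv 1 F), hF_fiber, hF_fiber, zero_smul, zero_smul, zero_add,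
    zero_add, Derivation.compAlgebraMap_apply] at h
  exact hF_t.smul_eq_zero.1 h.symm

theorem derivation_mk_baseParam_eq_zero (hu : IsUnit (∑ i, a i • δ i))
    {I : Ideal (TotalRing f δ a)} (hI : singIdeal f δ a ≤ I)
    (D : Derivation k (TotalRing f δ a ⧸ I) (TotalRing f δ a ⧸ I)) :
    D (Ideal.Quotient.mk I (baseParam f δ a)) = 0 := by
  have : Module.Finite (PowerSeries (PlaneRing k)) (TotalRing f δ a ⧸ I) :=
    .trans (TotalRing f δ a) _
  rw [baseParam_eq]
  refine derivation_algebraMap_powerSeries_X_eq_zero (A := TotalRing f δ a ⧸ I)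
    (F := deformationEq f δ a) ?_ (fun i => ?_) ?_ D
  · exact congrArg (Ideal.Quotient.mk I)
      (Ideal.Quotient.eq_zero_iff_mem.2 (Ideal.mem_span_singleton_self _))
  · exact Ideal.Quotient.eq_zero_iff_mem.2 (hI (Ideal.subset_span (by fin_cases i <;> simp)))
  · rw [derivative_deformationEq]
    exact hu.map PowerSeries.C

theorem IsPlanarICIS.baseParam_mem_of_singIdeal_le [CharZero k] (hf : IsPlanarICIS f)
    (hu : IsUnit (∑ i, a i • δ i)) {P : Ideal (TotalRing f δ a)} [P.IsPrime]
    (hP : singIdeal f δ a ≤ P) : baseParam f δ a ∈ P := by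
  have := isLocalRing_totalRing (δ := δ) (a := a) hf.vanishes
  have := hf.finite_quotient_jacobianIdeal
  have : Module.Finite k (CurveRing f ⧸ P.map (restrictSpecial f δ a)) :=
    finite_quotient_of_le k (map_singIdeal (f := f) (δ := δ) (a := a) ▸ Ideal.map_mono hP)
  have : Module.Finite k (TotalRing f δ a ⧸
      (Ideal.span {algebraMap (PowerSeries k) (TotalRing f δ a) PowerSeries.X} ⊔ P)) :=
    .equiv (quotientSpecialEquiv f δ a P).symm.toLinearEquiv
  have : Module.Finite (PowerSeries k) (TotalRing f δ a ⧸ P) :=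
    finite_powerSeries_quotient k (baseParam_mem_maximalIdeal hf.vanishes) P
  by_contra ht
  have hX : Ideal.Quotient.mk P (baseParam f δ a) ≠ 0 := fun h =>
    ht (Ideal.Quotient.eq_zero_iff_mem.1 h)
  obtain ⟨D, hD⟩ := exists_derivation_algebraMap_X_ne_zero k (O := TotalRing f δ a ⧸ P) hX
  exact hD (derivation_mk_baseParam_eq_zero hu hP D)

theorem IsPlanarICIS.isAdmissible_of_isUnit [CharZero k] (hf : IsPlanarICIS f)
    (hu : IsUnit (∑ i, a i • δ i)) : IsAdmissible f δ a := by
  have := isLocalRing_totalRing (δ := δ) (a := a) hf.vanishes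
  have := hf.finite_quotient_jacobianIdeal
  have : Module.Finite k (TotalRing f δ a ⧸ (specialFiberIdeal f δ a ⊔ singIdeal f δ a)) :=
    .equiv ((Ideal.quotientEquivAlgOfEq k (map_singIdeal (δ := δ) (a := a)).symm).trans
      (quotientSpecialEquiv f δ a _).symm).toLinearEquiv
  have : IsArtinianRing (TotalRing f δ a ⧸ (specialFiberIdeal f δ a ⊔ singIdeal f δ a)) :=
    .of_finite k _
  rw [IsAdmissible, Ideal.height_eq_inf_minimalPrimes]
  refine le_iInf₂ fun P hP => ?_
  have := hP.1.1
  have ht : specialFiberIdeal f δ a ≤ P :=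
    (Ideal.span_singleton_le_iff_mem P).2 (hf.baseParam_mem_of_singIdeal_le hu hP.1.2)
  rw [eq_maximalIdeal_of_isArtinianRing_quotient _ (sup_le ht hP.1.2), ← WithBot.coe_le_coe,
    maximalIdeal_height_eq_ringKrullDim, ringKrullDim_totalRing hf.vanishes hf.ne_zero]
  rfl

theorem singIdeal_eq_top (hf : IsPlanarICIS f) (h : tjurinaIdeal f = ⊤) :
    singIdeal f δ a = ⊤ := by
  have := isLocalRing_totalRing (δ := δ) (a := a) hf.vanishes
  have := isLocalRing_curveRing hf.vanishes
  have h₁ : 1 ∈ jacobianIdeal f :=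
    tjurinaIdeal_le_comap_jacobianIdeal (h ▸ Submodule.mem_top : (1 : PlaneRing k) ∈ _)
  obtain ⟨H, hH, hH1⟩ := exists_restrictSpecial_eq (δ := δ) (a := a) h₁
  have ht : baseParam f δ a ∣ 1 - H := by
    rw [← restrictSpecial_eq_zero_iff, map_sub, map_one, hH1, sub_self]
  by_contra hne
  refine (maximalIdeal (TotalRing f δ a)).ne_top_iff_one.1 Ideal.IsPrime.ne_top' ?_
  rw [← sub_add_cancel 1 H]
  exact add_mem (Ideal.mem_of_dvd _ ht (baseParam_mem_maximalIdeal hf.vanishes))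
    (le_maximalIdeal hne hH)

theorem IsDeformationBasis.exists_isUnit_sum (hδ : IsDeformationBasis f δ)
    (h : tjurinaIdeal f ≠ ⊤) : ∃ a : Fin d → k, IsUnit (∑ i, a i • δ i) := by
  obtain ⟨b, hb⟩ := hδ
  refine ⟨b.repr 1, ?_⟩
  have h₁ : Ideal.Quotient.mk (tjurinaIdeal f) (∑ i, b.repr 1 i • δ i) =
      Ideal.Quotient.mk (tjurinaIdeal f) 1 := by
    refine Eq.trans ?_ (b.sum_repr 1)
    simp only [hb, ← Ideal.Quotient.mkₐ_eq_mk k, map_sum, map_smul]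
  by_contra hu
  have h₂ := sub_mem hu (le_maximalIdeal h (Ideal.Quotient.eq.1 h₁))
  rw [sub_sub_cancel] at h₂
  exact h₂ isUnit_one

theorem exists_mvPolynomial_eval_eq (δ : Fin d → PlaneRing k) : ∃ p : MvPolynomial (Fin d) k,
    ∀ a, MvPolynomial.eval a p = MvPowerSeries.constantCoeff (∑ i, a i • δ i) :=
  ⟨∑ i, MvPolynomial.C (MvPowerSeries.constantCoeff (δ i)) * MvPolynomial.X i, fun a => by
    simp [mul_comm]⟩

theorem IsPlanarICIS.exists_forall_isAdmissible [CharZero k] (hf : IsPlanarICIS f)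
    (hδ : IsDeformationBasis f δ) : ∃ p : MvPolynomial (Fin d) k, p ≠ 0 ∧
      ∀ a : Fin d → k, MvPolynomial.eval a p ≠ 0 → IsAdmissible f δ a := by
  by_cases h : tjurinaIdeal f = ⊤
  · refine ⟨1, one_ne_zero, fun a _ => ?_⟩
    rw [IsAdmissible, singIdeal_eq_top hf h, Ideal.height_top]
    exact le_top
  obtain ⟨p, hp⟩ := exists_mvPolynomial_eval_eq δ
  have hp' (a : Fin d → k) : MvPolynomial.eval a p ≠ 0 ↔ IsUnit (∑ i, a i • δ i) := by
    rw [hp, ← isUnit_iff_ne_zero, MvPowerSeries.isUnit_iff_constantCoeff]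
  obtain ⟨a, ha⟩ := hδ.exists_isUnit_sum h
  refine ⟨p, ?_, fun a ha => hf.isAdmissible_of_isUnit ((hp' a).1 ha)⟩
  rintro rfl
  exact (hp' a).2 ha (map_zero _)

theorem mem_span_of_baseParam_mul_mem (hf0 : f ≠ 0) {H : TotalRing f δ a}
    (hH : restrictSpecial f δ a H ∈ nonZeroDivisors (CurveRing f)) {x : TotalRing f δ a}
    (hx : baseParam f δ a * x ∈ Ideal.span {H}) : x ∈ Ideal.span {H} := by
  obtain ⟨y, hy⟩ := Ideal.mem_span_singleton.1 hx
  have hHy : restrictSpecial f δ a H * restrictSpecial f δ a y = 0 := by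
    rw [← map_mul, restrictSpecial_eq_zero_iff, ← hy]
    exact dvd_mul_right _ _
  obtain ⟨z, rfl⟩ := restrictSpecial_eq_zero_iff.1 (mem_nonZeroDivisors_iff_left.1 hH _ hHy)
  rw [Ideal.mem_span_singleton, ← dvd_cancel_left_mem_nonZeroDivisors
    (baseParam_mem_nonZeroDivisors hf0), hy, mul_left_comm]
  exact mul_dvd_mul_left _ (dvd_mul_right _ _)

theorem genericMultiplicity_eq_specialMultiplicity (hf : MvPowerSeries.constantCoeff f = 0)
    (hf0 : f ≠ 0) (H : TotalRing f δ a)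
    [Module.Finite k (CurveRing f ⧸ Ideal.span {restrictSpecial f δ a H})] :
    genericMultiplicity f δ a (Ideal.span {H}) = specialMultiplicity f δ a (Ideal.span {H}) := by
  have := isLocalRing_totalRing (δ := δ) (a := a) hf
  have : Module.Finite k (CurveRing f ⧸ (Ideal.span {H}).map (restrictSpecial f δ a)) := by
    rwa [Ideal.map_span, Set.image_singleton]
  have : Module.Finite k (TotalRing f δ a ⧸
      (Ideal.span {algebraMap (PowerSeries k) (TotalRing f δ a) PowerSeries.X} ⊔ Ideal.span {H})) :=
    .equiv (quotientSpecialEquiv f δ a (Ideal.span {H})).symm.toLinearEquiv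
  have : Module.Finite (PowerSeries k) (TotalRing f δ a ⧸ Ideal.span {H}) :=
    finite_powerSeries_quotient k (baseParam_mem_maximalIdeal hf) _
  have : Module.Free (PowerSeries k) (TotalRing f δ a ⧸ Ideal.span {H}) :=
    free_quotient_of_irreducible_mul_mem PowerSeries.X_irreducible fun _ =>
      mem_span_of_baseParam_mul_mem hf0 (mem_nonZeroDivisors_of_finite_quotient hf hf0)
  rw [genericMultiplicity, vdim_eq_finrank, Module.finrank_baseChange,
    finrank_powerSeries_quotient k, specialMultiplicity, specialFiberIdeal, vdim_eq_finrank]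

theorem finite_quotient_of_specialMultiplicity_eq {H : TotalRing f δ a} {e : ℕ}
    (h : specialMultiplicity f δ a (Ideal.span {H}) = e) :
    Module.Finite k (CurveRing f ⧸ Ideal.span {restrictSpecial f δ a H}) :=
  finiteDimensional_of_vdim_eq_natCast (specialMultiplicity_span_singleton H ▸ h)

theorem restrictSpecial_mem_jacobianIdeal {H : TotalRing f δ a} (hH : H ∈ singIdeal f δ a) :
    restrictSpecial f δ a H ∈ jacobianIdeal f := by
  rw [← map_singIdeal (δ := δ) (a := a)]
  exact Ideal.mem_map_of_mem _ hH

theorem IsPlanarICIS.le_specialMultiplicity (hf : IsPlanarICIS f) {e : ℕ}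
    (he : HasHilbertSamuelMultiplicity k (jacobianIdeal f) e) {H : TotalRing f δ a}
    (hH : H ∈ singIdeal f δ a) : (e : ℕ∞) ≤ specialMultiplicity f δ a (Ideal.span {H}) := by
  rcases eq_or_ne (specialMultiplicity f δ a (Ideal.span {H})) ⊤ with h | h
  · exact h ▸ le_top
  obtain ⟨n, hn⟩ := ENat.ne_top_iff_exists.1 h
  have := finite_quotient_of_specialMultiplicity_eq hn.symm
  rw [specialMultiplicity_span_singleton, vdim_eq_finrank, Nat.cast_le]
  exact_mod_cast he.le_finrank (restrictSpecial_mem_jacobianIdeal hH)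
    (mem_nonZeroDivisors_of_finite_quotient hf.vanishes hf.ne_zero)

theorem IsPlanarICIS.exists_specialMultiplicity_eq [CharZero k] (hf : IsPlanarICIS f) {e : ℕ}
    (he : HasHilbertSamuelMultiplicity k (jacobianIdeal f) e) (ha : IsAdmissible f δ a)
    (θ : Module.Basis (Fin 2) (TotalRing f δ a)
      (Module.Dual (TotalRing f δ a) (PrincipalParts f δ a 2))) :
    ∃ τ, specialMultiplicity f δ a (degeneracyIdeal f δ a θ τ) = e := by
  obtain ⟨h, hh, hfin, heh⟩ := hf.exists_hasHilbertSamuelMultiplicity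
  obtain ⟨H, hH, rfl⟩ := exists_restrictSpecial_eq (δ := δ) (a := a) hh
  obtain ⟨τ, hτ⟩ := ha.exists_degeneracyIdeal_eq_span hf θ hH
  refine ⟨τ, ?_⟩
  rw [hτ, specialMultiplicity_span_singleton, vdim_eq_finrank, Nat.cast_inj]
  exact_mod_cast tendsto_nhds_unique heh.2 he.2

theorem exists_eval_ne_zero [Infinite k] {p : MvPolynomial (Fin d) k} (hp : p ≠ 0) :
    ∃ a, MvPolynomial.eval a p ≠ 0 := by
  by_contra! h
  exact hp (MvPolynomial.funext fun a => by rw [h, map_zero])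

theorem IsPlanarICIS.weightOneAutDeg_two_eq [CharZero k] (hf : IsPlanarICIS f)
    (hδ : IsDeformationBasis f δ) {e : ℕ}
    (he : HasHilbertSamuelMultiplicity k (jacobianIdeal f) e) : weightOneAutDeg 2 f δ = e := by
  refine le_antisymm ?_ (le_sInf ?_)
  · obtain ⟨p, hp0, hp⟩ := hf.exists_forall_isAdmissible hδ
    obtain ⟨a, ha⟩ := exists_eval_ne_zero hp0
    obtain ⟨τ, hτ⟩ := hf.exists_specialMultiplicity_eq he (hp a ha) (dualBasis hf (hp a ha))
    exact sInf_le ⟨a, hp a ha, _, τ, hτ.symm⟩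
  · rintro _ ⟨a, ha, θ, τ, rfl⟩
    obtain ⟨H, hH, hτ⟩ := ha.exists_degeneracyIdeal_eq hf θ τ
    exact hτ ▸ hf.le_specialMultiplicity he hH

theorem IsPlanarICIS.genericMultiplicity_degeneracyIdeal (hf : IsPlanarICIS f)
    (ha : IsAdmissible f δ a) (θ : Module.Basis (Fin 2) (TotalRing f δ a)
      (Module.Dual (TotalRing f δ a) (PrincipalParts f δ a 2)))
    {τ : Fin 2 → PrincipalParts f δ a 2} {e : ℕ}
    (hτ : specialMultiplicity f δ a (degeneracyIdeal f δ a θ τ) = e) :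
    genericMultiplicity f δ a (degeneracyIdeal f δ a θ τ) = e := by
  obtain ⟨H, -, hH⟩ := ha.exists_degeneracyIdeal_eq hf θ τ
  rw [hH] at hτ ⊢
  have := finite_quotient_of_specialMultiplicity_eq hτ
  exact (genericMultiplicity_eq_specialMultiplicity hf.vanishes hf.ne_zero H).trans hτ

end GenericDeformation

end AutDeg

end

theorem mainTheorem8_general {k : Type*} [Field k] [CharZero k]
    (f : AutDeg.PlaneRing k) (hf : AutDeg.IsPlanarICIS f)
    {d : ℕ} (δ : Fin d → AutDeg.PlaneRing k) (hδ : AutDeg.IsDeformationBasis f δ) :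
    ∃ e : ℕ,
      AutDeg.HasHilbertSamuelMultiplicity k (AutDeg.jacobianIdeal f) (e : ℝ) ∧
      AutDeg.weightOneAutDeg 2 f δ = (e : ℕ∞) ∧
      ∃ p : MvPolynomial (Fin d) k, p ≠ 0 ∧
        ∀ a : Fin d → k, MvPolynomial.eval a p ≠ 0 →
          AutDeg.IsAdmissible f δ a ∧
          Nonempty (Module.Basis (Fin 2) (AutDeg.TotalRing f δ a)
            (Module.Dual (AutDeg.TotalRing f δ a) (AutDeg.PrincipalParts f δ a 2))) ∧
          ∀ θ : Module.Basis (Fin 2) (AutDeg.TotalRing f δ a)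
              (Module.Dual (AutDeg.TotalRing f δ a) (AutDeg.PrincipalParts f δ a 2)),
            (∃ τ : Fin 2 → AutDeg.PrincipalParts f δ a 2,
              AutDeg.specialMultiplicity f δ a (AutDeg.degeneracyIdeal f δ a θ τ) =
                AutDeg.weightOneAutDeg 2 f δ) ∧
            ∀ τ : Fin 2 → AutDeg.PrincipalParts f δ a 2,
              AutDeg.specialMultiplicity f δ a (AutDeg.degeneracyIdeal f δ a θ τ) =
                AutDeg.weightOneAutDeg 2 f δ →
              AutDeg.genericMultiplicity f δ a (AutDeg.degeneracyIdeal f δ a θ τ) =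
                (e : ℕ∞) := by
  obtain ⟨h, -, -, he⟩ := hf.exists_hasHilbertSamuelMultiplicity
  obtain ⟨p, hp0, hp⟩ := hf.exists_forall_isAdmissible hδ
  have hAD := hf.weightOneAutDeg_two_eq hδ he
  refine ⟨_, he, hAD, p, hp0, fun a ha => ⟨hp a ha, ⟨AutDeg.dualBasis hf (hp a ha)⟩, fun θ => ?_⟩⟩
  rw [hAD]
  exact ⟨hf.exists_specialMultiplicity_eq he (hp a ha) θ,
    fun τ hτ => hf.genericMultiplicity_degeneracyIdeal (hp a ha) θ hτ⟩

theorem mainTheorem8 {k : Type*} [Field k] [IsAlgClosed k] [CharZero k]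
    (f : AutDeg.PlaneRing k) (hf : AutDeg.IsPlanarICIS f)
    {d : ℕ} (δ : Fin d → AutDeg.PlaneRing k) (hδ : AutDeg.IsDeformationBasis f δ) :
    ∃ e : ℕ,
      AutDeg.HasHilbertSamuelMultiplicity k (AutDeg.jacobianIdeal f) (e : ℝ) ∧
      AutDeg.weightOneAutDeg 2 f δ = (e : ℕ∞) ∧
      ∃ p : MvPolynomial (Fin d) k, p ≠ 0 ∧
        ∀ a : Fin d → k, MvPolynomial.eval a p ≠ 0 →
          AutDeg.IsAdmissible f δ a ∧
          Nonempty (Module.Basis (Fin 2) (AutDeg.TotalRing f δ a)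
            (Module.Dual (AutDeg.TotalRing f δ a) (AutDeg.PrincipalParts f δ a 2))) ∧
          ∀ θ : Module.Basis (Fin 2) (AutDeg.TotalRing f δ a)
              (Module.Dual (AutDeg.TotalRing f δ a) (AutDeg.PrincipalParts f δ a 2)),
            (∃ τ : Fin 2 → AutDeg.PrincipalParts f δ a 2,
              AutDeg.specialMultiplicity f δ a (AutDeg.degeneracyIdeal f δ a θ τ) =
                AutDeg.weightOneAutDeg 2 f δ) ∧
            ∀ τ : Fin 2 → AutDeg.PrincipalParts f δ a 2,
              AutDeg.specialMultiplicity f δ a (AutDeg.degeneracyIdeal f δ a θ τ) =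
                AutDeg.weightOneAutDeg 2 f δ →
              AutDeg.genericMultiplicity f δ a (AutDeg.degeneracyIdeal f δ a θ τ) =
                (e : ℕ∞) :=
  mainTheorem8_general f hf δ hδ
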